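/- Let $0<\alpha<1$, $T>0$, and let $\Omega\subset\mathbb R^d$ be a bounded domain (Lipschitz, with $d\in\{1,2,3\}$, in the paper; any bounded open set in any dimension is allowed). Let $$\mathcal L v=\sum_{k=1}^d\bigl\{-a_k(x)\,\partial_{x_k}^2v+b_k(x)\,\partial_{x_k}v\bigr\}+c(x)\,v$$ with $a_k,b_k,c\in C(\bar\Omega)$, $a_k>0$ and $c\ge\lambda$ in $\bar\Omega$, for some constant $\lambda\ge0$. For $t>0$ let $D_t^\alpha$ be the Caputo derivative $$D_t^\alpha v(t)=\frac1{\Gamma(1-\alpha)}\int_0^t(t-s)^{-\alpha}\,\partial_sv(s)\,ds ,$$ understood, for functions that are less regular or discontinuous at $t=0$, in the equivalent form $$\Gamma(1-\alpha)\,D_t^\alpha v(t)=t^{-\alpha}\{v(t)-v(0)\}+\alpha\int_0^t(t-s)^{-\alpha-1}\{v(t)-v(s)\}\,ds .$$ Let $u$ solve $D_t^\alpha u+\mathcal Lu=f$ in $\Omega\times(0,T]$, $u(\cdot,0)=u_0$ in $\Omega$, $u=0$ on $\partial\Omega$ for $0<t\le T$, and let $u_h$ be an approximation with $u_h(\cdot,0)=u_0$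 in $\Omega$ and $u_h=0$ on $\partial\Omega$ for $0<t\le T$. Suppose that $u$ and $u_h$ are in $C(\bar\Omega\times[0,t])\cap W^{1,\infty}(\epsilon,t;L_\infty(\Omega))$ for all $0<\epsilon<t\le T$, and in $C^2(\Omega)$ for each $t\in(0,T]$. Set $e=u_h-u$, $R_h(\cdot,t)=(D_t^\alpha+\mathcal L)u_h(\cdot,t)-f(\cdot,t)$, and write $\|\cdot\|=\|\cdot\|_{L_\infty(\Omega)}\in[0,\infty]$. Then the following holds. (i) For $0<t\le T$, $$\|e(\cdot,t)\|\le\int_0^t(t-s)^{\alpha-1}E_{\alpha,\alpha}\bigl(-\lambda(t-s)^\alpha\bigr)\,\|R_h(\cdot,s)\|\,ds,\qquad E_{\alpha,\beta}(z)=\sum_{k=0}^\infty\frac{z^k}{\Gamma(\alpha k+\beta)} .$$ (ii) Let $\mathcal E\ge0$ be a function on $[0,T]$ that is continuous on $(0,T]$ and for which the integral that defines $D_t^\alpha\mathcal E(t)$ converges absolutely for each $t\in(0,T]$. If $\|R_h(\cdot,t)\|\le(D_t^\alpha+\lambda)\mathcal E(t)$ for all $0<t\le T$, then $\|e(\cdot,t)\|\le\mathcal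 E(t)$ for all $0\le t\le T$. (iii) For $0<t\le T$ and every $\tau>0$, $$\|e(\cdot,t)\|\le\sup_{0<s\le t}\frac{\|R_h(\cdot,s)\|}{\mathcal R_0(s)},\qquad \|e(\cdot,t)\|\le\mathcal E_1(t)\sup_{0<s\le t}\frac{\|R_h(\cdot,s)\|}{\mathcal R_1(s)}\le t^{\alpha-1}\sup_{0<s\le t}\frac{\|R_h(\cdot,s)\|}{\mathcal R_1(s)},$$ where $\mathcal R_0(t)=\Gamma(1-\alpha)^{-1}t^{-\alpha}+\lambda$, $\mathcal R_1(t)=\Gamma(1-\alpha)^{-1}t^{-1}\rho(\tau/t)+\lambda\,\mathcal E_1(t)$, $\mathcal E_1(t)=\max\{\tau,t\}^{\alpha-1}$, and $\rho(s)=s^{-\beta}\bigl[1-(\max\{0,1-s\})^\beta\bigr]\ge s^{-\beta}\min\{\beta s,1\}$ for $s>0$, with $\beta=1-\alpha$. -/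

import Mathlib

open Set Filter Topology MeasureTheory
open scoped ENNReal NNReal ContDiff

noncomputable section

namespace TimeFrac

/-! ### The Caputo derivative -/

/-- The integrand `(t - s)^{-α-1} (v t - v s)` of the regularized form of the Caputo derivative. -/
def caputoIntegrand (α : ℝ) (v : ℝ → ℝ) (t s : ℝ) : ℝ :=
  (t - s) ^ (-α - 1) * (v t - v s)

/-- The Caputo derivative of order `α ∈ (0,1)` at time `t > 0`, in the form
`Γ(1-α)⁻¹ (t^{-α} (v t - v 0) + α ∫₀ᵗ (t-s)^{-α-1} (v t - v s) ds)`,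
which makes sense for functions that are merely Lipschitz away from `0`, and for functions that
jump at `0` (a jump contributes the Dirac mass of `∂ₜ v` at `0`).
For `v` continuous at `0` and Lipschitz on every `[ε, t]` it is
`J_t^{1-α} (∂ₜ v) = Γ(1-α)⁻¹ ∫₀ᵗ (t-s)^{-α} ∂ₛ v s ds`, the integral being improper at `0` if
`∂ₛ v` is not integrable there: see `caputo_tendsto` and `caputo_eq_integral_deriv`. -/
def caputo (α : ℝ) (v : ℝ → ℝ) (t : ℝ) : ℝ :=
  (Real.Gamma (1 - α))⁻¹ *
    (t ^ (-α) * (v t - v 0) + α * ∫ s in Ioo 0 t, caputoIntegrand α v t s)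

/-- The integral that defines `caputo α v t` converges. -/
def HasCaputo (α : ℝ) (v : ℝ → ℝ) (t : ℝ) : Prop :=
  IntegrableOn (caputoIntegrand α v t) (Ioo 0 t)

/-! ### The inverse of `D_t^α + λ` -/

/-- The two-parameter Mittag-Leffler function `E_{α,β}(z) = ∑ₖ zᵏ / Γ(αk+β)`. -/
def mittagLeffler (α β z : ℝ) : ℝ :=
  ∑' k : ℕ, (Real.Gamma (α * k + β))⁻¹ * z ^ k

/-- `(D_t^α + λ)⁻¹ v (t) = ∫₀ᵗ (t-s)^{α-1} E_{α,α}(-λ (t-s)^α) v(s) ds` for `v ≥ 0` with values in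
`[0, ∞]` (the kernel is positive). -/
def invCaputoAdd (α lam : ℝ) (v : ℝ → ℝ≥0∞) (t : ℝ) : ℝ≥0∞ :=
  ∫⁻ s in Ioo 0 t,
    ENNReal.ofReal ((t - s) ^ (α - 1) * mittagLeffler α α (-lam * (t - s) ^ α)) * v s

/-! ### Residual barriers -/

/-- `ρ(s) = s^{-β} [1 - ((1-s)⁺)^β]` with `β = 1 - α`. -/
def rho (α s : ℝ) : ℝ :=
  s ^ (-(1 - α)) * (1 - (max 0 (1 - s)) ^ (1 - α))

/-- `𝓡₀(t) = Γ(1-α)⁻¹ t^{-α} + λ`. -/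
def barrierR₀ (α lam t : ℝ) : ℝ :=
  (Real.Gamma (1 - α))⁻¹ * t ^ (-α) + lam

/-- `𝓔₁(t) = max{τ, t}^{α-1}` (for `t > 0`). -/
def barrierE₁ (α τ t : ℝ) : ℝ :=
  (max τ t) ^ (α - 1)

/-- `𝓡₁(t) = Γ(1-α)⁻¹ t⁻¹ ρ(τ/t) + λ 𝓔₁(t)`. -/
def barrierR₁ (α lam τ t : ℝ) : ℝ :=
  (Real.Gamma (1 - α))⁻¹ * t⁻¹ * rho α (τ / t) + lam * barrierE₁ α τ t

/-! ### The spatial operator, norms and function spaces -/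

/-- The partial derivative `∂_{x_k} v (x)`. -/
def partialDeriv {d : ℕ} (k : Fin d) (v : EuclideanSpace ℝ (Fin d) → ℝ)
    (x : EuclideanSpace ℝ (Fin d)) : ℝ :=
  lineDeriv ℝ v x (EuclideanSpace.single k 1)

/-- `𝓛 v = ∑ₖ (-aₖ ∂²_{x_k} v + bₖ ∂_{x_k} v) + c v`. -/
def spatialOp {d : ℕ} (a b : Fin d → EuclideanSpace ℝ (Fin d) → ℝ)
    (c : EuclideanSpace ℝ (Fin d) → ℝ) (v : EuclideanSpace ℝ (Fin d) → ℝ)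
    (x : EuclideanSpace ℝ (Fin d)) : ℝ :=
  ∑ k, (-a k x * partialDeriv k (partialDeriv k v) x + b k x * partialDeriv k v x) + c x * v x

/-- The `L_∞(Ω)` norm (with value `∞` if `v` is not essentially bounded). -/
def normLinf {d : ℕ} (Ω : Set (EuclideanSpace ℝ (Fin d)))
    (v : EuclideanSpace ℝ (Fin d) → ℝ) : ℝ≥0∞ :=
  eLpNorm v ∞ (volume.restrict Ω)

/-- `v ∈ W^{1,∞}(t₁, t₂; L_∞(Ω))`: as a function of time with values in `L_∞(Ω)`, `v` is
(Bochner) measurable and essentially bounded, and so is its weak derivative `G`. -/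
def MemW1Inf {d : ℕ} (Ω : Set (EuclideanSpace ℝ (Fin d))) (t₁ t₂ : ℝ)
    (v : EuclideanSpace ℝ (Fin d) → ℝ → ℝ) : Prop :=
  ∃ V G : ℝ → Lp ℝ ∞ (volume.restrict Ω),
    (∀ᵐ t ∂volume.restrict (Ioo t₁ t₂), V t =ᵐ[volume.restrict Ω] fun x => v x t) ∧
    MemLp V ∞ (volume.restrict (Ioo t₁ t₂)) ∧
    MemLp G ∞ (volume.restrict (Ioo t₁ t₂)) ∧
    ∀ φ : ℝ → ℝ, ContDiff ℝ ∞ φ → HasCompactSupport φ → tsupport φ ⊆ Ioo t₁ t₂ →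
      ∫ t in Ioo t₁ t₂, deriv φ t • V t = -∫ t in Ioo t₁ t₂, φ t • G t

/-- The regularity class: `v ∈ C(Ω̄ × [0,t]) ∩ W^{1,∞}(ε, t; L_∞(Ω))` for all `0 < ε < t ≤ T`, and
`v(·,t) ∈ C²(Ω)` for all `0 < t ≤ T`. -/
structure Regular {d : ℕ} (Ω : Set (EuclideanSpace ℝ (Fin d))) (T : ℝ)
    (v : EuclideanSpace ℝ (Fin d) → ℝ → ℝ) : Prop where
  continuousOn : ContinuousOn (fun p : EuclideanSpace ℝ (Fin d) × ℝ => v p.1 p.2)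
    (closure Ω ×ˢ Icc 0 T)
  memW1Inf : ∀ ε t : ℝ, 0 < ε → ε < t → t ≤ T → MemW1Inf Ω ε t v
  contDiffOn : ∀ t ∈ Ioc 0 T, ContDiffOn ℝ 2 (fun x => v x t) Ω

/-- `R(x,t) = (D_t^α + 𝓛) w (x,t) - f(x,t)`. -/
def residual {d : ℕ} (α : ℝ) (a b : Fin d → EuclideanSpace ℝ (Fin d) → ℝ)
    (c : EuclideanSpace ℝ (Fin d) → ℝ) (f w : EuclideanSpace ℝ (Fin d) → ℝ → ℝ)
    (x : EuclideanSpace ℝ (Fin d)) (t : ℝ) : ℝ :=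
  caputo α (w x) t + spatialOp a b c (fun y => w y t) x - f x t

/-- `w` satisfies the initial condition `w(·,0) = u₀` in `Ω` and the boundary condition `w = 0` on
`∂Ω` for `0 < t ≤ T`. -/
structure HasData {d : ℕ} (Ω : Set (EuclideanSpace ℝ (Fin d))) (T : ℝ)
    (u₀ : EuclideanSpace ℝ (Fin d) → ℝ) (w : EuclideanSpace ℝ (Fin d) → ℝ → ℝ) : Prop where
  initial : ∀ x ∈ Ω, w x 0 = u₀ x
  boundary : ∀ x ∈ frontier Ω, ∀ t ∈ Ioc 0 T, w x t = 0

/-! ### The Caputo derivative as `J_t^{1-α} ∂ₜ` -/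

/-- For `v` continuous at `0` and Lipschitz on every `[ε, t]`, `caputo α v t` is the improper integral
`Γ(1-α)⁻¹ ∫₀ᵗ (t-s)^{-α} ∂ₛ v s ds`. -/
theorem caputo_tendsto {α t : ℝ} (hα : α ∈ Ioo (0 : ℝ) 1) (ht : 0 < t) {v : ℝ → ℝ}
    (hv0 : Tendsto v (𝓝[>] 0) (𝓝 (v 0)))
    (hv : ∀ ε ∈ Ioo 0 t, ∃ K : ℝ≥0, LipschitzOnWith K v (Icc ε t)) :
    Tendsto (fun ε => (Real.Gamma (1 - α))⁻¹ * ∫ s in Ioo ε t, (t - s) ^ (-α) * deriv v s)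
      (𝓝[>] 0) (𝓝 (caputo α v t)) := by
  obtain ⟨hα0, hα1⟩ := hα
  -- continuity of `v` away from zero
  have hvc : ContinuousOn v (Ioc 0 t) := by
    intro x hx
    obtain ⟨K, hK⟩ := hv (x / 2) ⟨by linarith [hx.1], by linarith [hx.1, hx.2]⟩
    refine (hK.continuousOn x ⟨by linarith [hx.1], hx.2⟩).mono_of_mem_nhdsWithin ?_
    have : Ioi (x / 2) ∩ Ioc 0 t ∈ 𝓝[Ioc 0 t] x :=
      inter_mem (mem_nhdsWithin_of_mem_nhds (Ioi_mem_nhds (by linarith [hx.1])))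
        self_mem_nhdsWithin
    exact mem_of_superset this fun y hy => ⟨le_of_lt hy.1, hy.2.2⟩
  have hpw : ∀ p : ℝ, ContinuousOn (fun s : ℝ => (t - s) ^ p) (Iio t) := fun p =>
    ContinuousOn.rpow_const (by fun_prop) fun s hs => Or.inl (sub_pos.2 hs).ne'
  have hIc : ContinuousOn (caputoIntegrand α v t) (Ioo 0 t) :=
    ((hpw _).mono fun s hs => hs.2).mul
      (continuousOn_const.sub (hvc.mono Ioo_subset_Ioc_self))
  have hpint : ∀ p : ℝ, -1 < p → ∀ ε : ℝ,
      IntervalIntegrable (fun s : ℝ => (t - s) ^ p) volume ε t := by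
    intro p hp ε
    have := (intervalIntegral.intervalIntegrable_rpow' (a := t - ε) (b := 0) hp).comp_sub_left t
    simpa using this
  -- Lipschitz bound of the integrand
  have hIb : ∀ ε ∈ Ioo 0 t, ∃ K : ℝ≥0, LipschitzOnWith K v (Icc ε t) ∧
      ∀ s ∈ Ico ε t, |caputoIntegrand α v t s| ≤ K * (t - s) ^ (-α) := by
    intro ε hε
    obtain ⟨K, hK⟩ := hv ε hε
    refine ⟨K, hK, fun s hs => ?_⟩
    have hts : 0 < t - s := sub_pos.2 hs.2
    have h1 := hK.dist_le_mul t ⟨hε.2.le, le_rfl⟩ s ⟨hs.1, hs.2.le⟩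
    rw [Real.dist_eq, Real.dist_eq, abs_of_pos hts] at h1
    rw [caputoIntegrand, abs_mul, abs_of_pos (Real.rpow_pos_of_pos hts _)]
    calc (t - s) ^ (-α - 1) * |v t - v s| ≤ (t - s) ^ (-α - 1) * (K * (t - s)) := by gcongr
      _ = K * ((t - s) ^ (-α - 1) * (t - s)) := by ring
      _ = K * (t - s) ^ (-α) := by
        rw [← Real.rpow_add_one hts.ne']; congr 2; ring
  -- the integrand is integrable up to `t`
  have hIint : ∀ ε ∈ Ioo 0 t, IntegrableOn (caputoIntegrand α v t) (Ioo ε t) := by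
    intro ε hε
    obtain ⟨K, -, hK⟩ := hIb ε hε
    have hg : IntegrableOn (fun s : ℝ => (K : ℝ) * (t - s) ^ (-α)) (Ioo ε t) :=
      (((intervalIntegrable_iff_integrableOn_Ioo_of_le hε.2.le).1
        (hpint (-α) (by linarith) ε))).const_mul _
    refine Integrable.mono' hg
      ((hIc.mono (Ioo_subset_Ioo_left hε.1.le)).aestronglyMeasurable measurableSet_Ioo) ?_
    refine (ae_restrict_iff' measurableSet_Ioo).2 (Eventually.of_forall fun s hs => ?_)
    exact hK s ⟨hs.1.le, hs.2⟩
  -- and near zero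
  have hIint0 : IntegrableOn (caputoIntegrand α v t) (Ioo 0 t) := by
    have hb : ∀ᶠ s in 𝓝[>] (0 : ℝ), |v s| ≤ |v 0| + 1 :=
      (hv0.abs).eventually_le_const (by linarith)
    obtain ⟨δ, hδ0, hδ⟩ := mem_nhdsGT_iff_exists_Ioo_subset.1 hb
    have hδ0 : 0 < δ := hδ0
    set η := min δ (t / 2) with hη
    have hη0 : 0 < η := lt_min hδ0 (by linarith)
    have hηt : η ≤ t / 2 := min_le_right _ _
    have hsub : Ioo 0 t ⊆ Ioc 0 (η / 2) ∪ Ioo (η / 2) t := fun s hs => by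
      rcases le_or_gt s (η / 2) with h | h
      · exact Or.inl ⟨hs.1, h⟩
      · exact Or.inr ⟨h, hs.2⟩
    refine IntegrableOn.mono_set (IntegrableOn.union ?_
      (hIint (η / 2) ⟨by linarith, by linarith⟩)) hsub
    refine Integrable.mono'
      (integrableOn_const (C := (t / 2) ^ (-α - 1) * (|v t| + (|v 0| + 1)))
        measure_Ioc_lt_top.ne)
      ((hIc.mono fun s hs => ⟨hs.1, by linarith [hs.2]⟩).aestronglyMeasurable
        measurableSet_Ioc) ?_
    refine (ae_restrict_iff' measurableSet_Ioc).2 (Eventually.of_forall fun s hs => ?_)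
    have hs1 : |v s| ≤ |v 0| + 1 :=
      hδ ⟨hs.1, by linarith [hs.2, min_le_left δ (t / 2)]⟩
    have hts : t / 2 ≤ t - s := by linarith [hs.2]
    rw [Real.norm_eq_abs, caputoIntegrand, abs_mul,
      abs_of_pos (Real.rpow_pos_of_pos (by linarith) _)]
    have h2 : (t - s) ^ (-α - 1) ≤ (t / 2) ^ (-α - 1) :=
      Real.rpow_le_rpow_of_nonpos (by linarith) hts (by linarith)
    have h3 : |v t - v s| ≤ |v t| + (|v 0| + 1) := (abs_sub _ _).trans (by linarith)
    gcongr
  -- integration by parts on `[ε, t]`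
  have key : ∀ ε ∈ Ioo 0 t, ∫ s in Ioo ε t, (t - s) ^ (-α) * deriv v s =
      (t - ε) ^ (-α) * (v t - v ε) + α * ∫ s in Ioo ε t, caputoIntegrand α v t s := by
    intro ε hε
    obtain ⟨K, hL, hK⟩ := hIb ε hε
    have hder : ∀ s ∈ Ioo ε t, |deriv v s| ≤ K := fun s hs => by
      have := norm_deriv_le_of_lipschitzOn (Icc_mem_nhds hs.1 hs.2) hL
      simpa using this
    have hfint : IntegrableOn (fun s => (t - s) ^ (-α) * deriv v s) (Ioo ε t) := by
      have hg : IntegrableOn (fun s : ℝ => (K : ℝ) * (t - s) ^ (-α)) (Ioo ε t) :=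
        (((intervalIntegrable_iff_integrableOn_Ioo_of_le hε.2.le).1
          (hpint (-α) (by linarith) ε))).const_mul _
      refine Integrable.mono' hg ((((hpw _).mono fun s hs => hs.2).aestronglyMeasurable
        measurableSet_Ioo).mul (measurable_deriv v).aestronglyMeasurable) ?_
      refine (ae_restrict_iff' measurableSet_Ioo).2 (Eventually.of_forall fun s hs => ?_)
      have hts : 0 < t - s := sub_pos.2 hs.2
      rw [Real.norm_eq_abs, abs_mul, abs_of_pos (Real.rpow_pos_of_pos hts _), mul_comm]
      gcongr
      exact hder s hs
    have hparts : ∀ η ∈ Ioo ε t, ∫ s in ε..η, (t - s) ^ (-α) * deriv v s =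
        (t - ε) ^ (-α) * (v t - v ε) - (t - η) ^ (-α) * (v t - v η)
          + α * ∫ s in ε..η, caputoIntegrand α v t s := by
      intro η hη
      have hu : uIcc ε η = Icc ε η := uIcc_of_le hη.1.le
      have hF : AbsolutelyContinuousOnInterval (fun s : ℝ => (t - s) ^ (-α)) ε η := by
        apply ContDiffOn.absolutelyContinuousOnInterval
        rw [hu]
        refine ContDiffOn.rpow_const_of_ne (by fun_prop) fun s hs => ?_
        linarith [hs.2, hη.2]
      have hG : AbsolutelyContinuousOnInterval (fun s : ℝ => v s - v t) ε η := by
        apply LipschitzOnWith.absolutelyContinuousOnInterval (K := K)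
        rw [hu]
        refine LipschitzOnWith.of_dist_le_mul fun x hx y hy => ?_
        rw [dist_sub_right]
        exact hL.dist_le_mul x ⟨hx.1, hx.2.trans hη.2.le⟩ y ⟨hy.1, hy.2.trans hη.2.le⟩
      have h := hF.integral_mul_deriv_eq_deriv_mul hG
      have h1 : ∀ s, deriv (fun s : ℝ => v s - v t) s = deriv v s := fun s => deriv_sub_const _
      simp only [h1] at h
      rw [h, ← intervalIntegral.integral_const_mul]
      have h2 : ∫ s in ε..η, deriv (fun s : ℝ => (t - s) ^ (-α)) s * (v s - v t) =
          ∫ s in ε..η, -(α * caputoIntegrand α v t s) := by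
        refine intervalIntegral.integral_congr fun s hs => ?_
        rw [hu] at hs
        have hts : 0 < t - s := by linarith [hs.2, hη.2]
        have hd : HasDerivAt (fun s : ℝ => (t - s) ^ (-α)) (-1 * (-α) * (t - s) ^ (-α - 1)) s :=
          ((hasDerivAt_id s).const_sub t).rpow_const (Or.inl hts.ne')
        simp only [hd.deriv, caputoIntegrand]
        ring
      rw [h2, intervalIntegral.integral_neg]
      ring
    have hconv : ∀ g : ℝ → ℝ, IntegrableOn g (Ioo ε t) →
        Tendsto (fun η => ∫ s in ε..η, g s) (𝓝[<] t) (𝓝 (∫ s in Ioo ε t, g s)) := by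
      intro g hg
      have hgi : IntegrableOn g (Icc ε t) :=
        (integrableOn_Icc_iff_integrableOn_Ioo enorm_ne_top enorm_ne_top).2 hg
      have hc := intervalIntegral.continuousOn_primitive_interval (f := g) (μ := volume)
        (a := ε) (b := t) (by rwa [uIcc_of_le hε.2.le])
      have hc' := hc t (right_mem_uIcc)
      rw [uIcc_of_le hε.2.le] at hc'
      have hc'' := hc'.mono_left (nhdsWithin_mono t Ioo_subset_Icc_self)
      rw [nhdsWithin_Ioo_eq_nhdsLT hε.2] at hc''
      beta_reduce at hc''
      rwa [intervalIntegral.integral_of_le hε.2.le, integral_Ioc_eq_integral_Ioo] at hc''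
    have hz : Tendsto (fun η => (t - η) ^ (-α) * (v t - v η)) (𝓝[<] t) (𝓝 0) := by
      have hlim : Tendsto (fun η : ℝ => (K : ℝ) * (t - η) ^ (1 - α)) (𝓝[<] t) (𝓝 0) := by
        have hcont : Continuous (fun η : ℝ => (K : ℝ) * (t - η) ^ (1 - α)) :=
          continuous_const.mul (Continuous.rpow_const (by fun_prop)
            fun _ => Or.inr (by linarith))
        have := hcont.tendsto t
        rw [sub_self, Real.zero_rpow (by linarith), mul_zero] at this
        exact this.mono_left nhdsWithin_le_nhds
      refine squeeze_zero_norm' ?_ hlim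
      filter_upwards [Ioo_mem_nhdsLT hε.2] with η hη
      have hts : 0 < t - η := sub_pos.2 hη.2
      have h := hK η ⟨hη.1.le, hη.2⟩
      have e1 : (t - η) ^ (-α) * (v t - v η) = (t - η) * caputoIntegrand α v t η := by
        have : (t - η) ^ (-α) = (t - η) ^ (-α - 1) * (t - η) := by
          rw [← Real.rpow_add_one hts.ne']; congr 1; ring
        rw [this, caputoIntegrand]; ring
      rw [e1, Real.norm_eq_abs, abs_mul, abs_of_pos hts]
      calc (t - η) * |caputoIntegrand α v t η| ≤ (t - η) * (K * (t - η) ^ (-α)) := by gcongr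
        _ = K * ((t - η) ^ (-α) * (t - η)) := by ring
        _ = K * (t - η) ^ (1 - α) := by
          rw [← Real.rpow_add_one hts.ne']; congr 2; ring
    have hA := hconv _ hfint
    have hB : Tendsto (fun η => (t - ε) ^ (-α) * (v t - v ε) - (t - η) ^ (-α) * (v t - v η)
          + α * ∫ s in ε..η, caputoIntegrand α v t s) (𝓝[<] t)
        (𝓝 ((t - ε) ^ (-α) * (v t - v ε) - 0
          + α * ∫ s in Ioo ε t, caputoIntegrand α v t s)) :=
      (hz.const_sub _).add ((hconv _ (hIint ε hε)).const_mul α)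
    rw [sub_zero] at hB
    refine tendsto_nhds_unique hA (hB.congr' ?_)
    filter_upwards [Ioo_mem_nhdsLT hε.2] with η hη
    exact (hparts η hη).symm
  -- the limit at zero
  have hlim : Tendsto (fun ε => ∫ s in Ioo ε t, caputoIntegrand α v t s) (𝓝[>] 0)
      (𝓝 (∫ s in Ioo 0 t, caputoIntegrand α v t s)) := by
    have hgi : IntegrableOn (caputoIntegrand α v t) (Icc 0 t) :=
      (integrableOn_Icc_iff_integrableOn_Ioo enorm_ne_top enorm_ne_top).2 hIint0
    have hc := intervalIntegral.continuousOn_primitive_interval_left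
      (f := caputoIntegrand α v t) (μ := volume) (a := 0) (b := t)
      (by rwa [uIcc_of_le ht.le])
    have hc' := hc 0 left_mem_uIcc
    rw [uIcc_of_le ht.le] at hc'
    have hc'' := hc'.mono_left (nhdsWithin_mono 0 Ioo_subset_Icc_self)
    rw [nhdsWithin_Ioo_eq_nhdsGT ht] at hc''
    beta_reduce at hc''
    rw [intervalIntegral.integral_of_le ht.le, integral_Ioc_eq_integral_Ioo] at hc''
    refine hc''.congr' ?_
    filter_upwards [Ioo_mem_nhdsGT ht] with ε hε
    rw [intervalIntegral.integral_of_le hε.2.le, integral_Ioc_eq_integral_Ioo]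
  have hpw0 : Tendsto (fun ε : ℝ => (t - ε) ^ (-α)) (𝓝[>] 0) (𝓝 (t ^ (-α))) := by
    have := ((hpw (-α)).continuousAt (Iio_mem_nhds ht)).tendsto
    rw [sub_zero] at this
    exact this.mono_left nhdsWithin_le_nhds
  have hfin := (((hpw0.mul (hv0.const_sub (v t))).add (hlim.const_mul α))).const_mul
    (Real.Gamma (1 - α))⁻¹
  refine Tendsto.congr' ?_ hfin
  filter_upwards [Ioo_mem_nhdsGT ht] with ε hε
  rw [key ε hε]

/-- `caputo α v t = Γ(1-α)⁻¹ ∫₀ᵗ (t-s)^{-α} ∂ₛ v s ds`, if `v` is continuous at `0` and Lipschitz on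
every `[ε, t]`, and the integral converges. -/
theorem caputo_eq_integral_deriv {α t : ℝ} (hα : α ∈ Ioo (0 : ℝ) 1) (ht : 0 < t) {v : ℝ → ℝ}
    (hv0 : Tendsto v (𝓝[>] 0) (𝓝 (v 0)))
    (hv : ∀ ε ∈ Ioo 0 t, ∃ K : ℝ≥0, LipschitzOnWith K v (Icc ε t))
    (hint : IntegrableOn (fun s => (t - s) ^ (-α) * deriv v s) (Ioo 0 t)) :
    caputo α v t = (Real.Gamma (1 - α))⁻¹ * ∫ s in Ioo 0 t, (t - s) ^ (-α) * deriv v s := by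
  refine tendsto_nhds_unique (caputo_tendsto hα ht hv0 hv) (Tendsto.const_mul _ ?_)
  have hgi :=
    (integrableOn_Icc_iff_integrableOn_Ioo enorm_ne_top enorm_ne_top).2 hint
  have hc := intervalIntegral.continuousOn_primitive_interval_left
    (f := fun s => (t - s) ^ (-α) * deriv v s) (μ := volume) (a := 0) (b := t)
    (by rwa [uIcc_of_le ht.le])
  have hc' := hc 0 left_mem_uIcc
  rw [uIcc_of_le ht.le] at hc'
  have hc'' := hc'.mono_left (nhdsWithin_mono 0 Ioo_subset_Icc_self)
  rw [nhdsWithin_Ioo_eq_nhdsGT ht] at hc''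
  beta_reduce at hc''
  rw [intervalIntegral.integral_of_le ht.le, integral_Ioc_eq_integral_Ioo] at hc''
  refine hc''.congr' ?_
  filter_upwards [Ioo_mem_nhdsGT ht] with ε hε
  rw [intervalIntegral.integral_of_le hε.2.le, integral_Ioc_eq_integral_Ioo]

end TimeFrac

end

/- At a point `x` where `|e(·, t)|` attains its maximum `m t`, the spatial derivatives of `e` have
the sign that gives `|𝓛 e| ≥ λ m` there, while `m s ≥ |e(x, s)|` for all `s` shows that the Caputo
derivative of `m` at `t` is at most that of `|e(x, ·)|`. Hence `m` satisfies the scalar inequality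
`(D_t^α + λ) m ≤ ‖R_h‖`, `m 0 = 0`.

The scalar problem has a comparison principle, since at a positive maximum the regularized form of
the Caputo derivative is positive. It bounds `m` by every barrier `𝓔`; the functions that vanish at
`t = 0` and equal `1` or `𝓔₁` for `t > 0` have the images `𝓡₀` and `𝓡₁` under `D_t^α + λ`, which
gives the bounds with suprema. The bound by the inverse operator rests on the identity
`𝓡₀ * k = 1` for its kernel `k`, as `(D_t^α + λ) v = 𝓡₀ * v'` when `v 0 = 0`, and on `k ≥ 0`: the
primitive of `k` solves the problem with right-hand side `1`, and it increases because by comparison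
it dominates its own delays. -/

noncomputable section

namespace TimeFrac

section HalfConv

variable {f g w : ℝ → ℝ} {t M : ℝ}

/-- The convolution `∫₀ˣ f(x-q) g(q) dq` of functions on the half-line; it is `0` for `x ≤ 0`. -/
def halfConv (f g : ℝ → ℝ) (x : ℝ) : ℝ := ∫ q in Ioo 0 x, f (x - q) * g q

theorem halfConv_comm (f g : ℝ → ℝ) (x : ℝ) : halfConv f g x = halfConv g f x := by
  rcases le_or_gt x 0 with hx | hx
  · simp [halfConv, Ioo_eq_empty (not_lt.2 hx)]
  · simp only [halfConv, ← integral_Ioc_eq_integral_Ioo, ← intervalIntegral.integral_of_le hx.le]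
    simpa [mul_comm] using
      (intervalIntegral.integral_comp_sub_left (fun q => f q * g (x - q)) x (a := 0) (b := x))

theorem halfConv_congr {f' g' : ℝ → ℝ} (hf : EqOn f f' (Ioo 0 t)) (hg : EqOn g g' (Ioo 0 t)) :
    halfConv f g t = halfConv f' g' t := by
  refine setIntegral_congr_fun measurableSet_Ioo fun q hq => ?_
  simp only [hf (show t - q ∈ Ioo 0 t from ⟨by linarith [hq.2], by linarith [hq.1]⟩), hg hq]

theorem integrableOn_comp_sub_left (hf : IntegrableOn f (Ioo 0 t)) :
    IntegrableOn (fun s => f (t - s)) (Ioo 0 t) := by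
  have h := (integrable_indicator_iff measurableSet_Ioo).2 hf |>.comp_sub_left t
  refine (integrable_indicator_iff measurableSet_Ioo).1 (h.congr (.of_forall fun s => ?_))
  simp only [indicator, mem_Ioo, sub_pos, sub_lt_self_iff, and_comm]

theorem halfConv_sub_eq_integral {q : ℝ} :
    halfConv f g (t - q) = ∫ s in Ioo q t, f (t - s) * g (s - q) := by
  rcases le_or_gt t q with h | h
  · simp [halfConv, Ioo_eq_empty (not_lt.2 h), Ioo_eq_empty (not_lt.2 (sub_nonpos.2 h))]
  · simp only [halfConv, ← integral_Ioc_eq_integral_Ioo,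
      ← intervalIntegral.integral_of_le h.le, ← intervalIntegral.integral_of_le (sub_pos.2 h).le]
    have := intervalIntegral.integral_comp_sub_right
      (fun r => f (t - q - r) * g r) q (a := q) (b := t)
    rw [sub_self] at this
    rw [← this]
    simp only [sub_sub_sub_cancel_right]

/-- The integrand of the iterated convolution `f * (g * w)` at time `t`, extended by zero outside
the triangle `0 < q < s < t`. -/
def triangleIntegrand (f g w : ℝ → ℝ) (t s q : ℝ) : ℝ :=
  (Ioo 0 t).indicator (fun s => f (t - s)) s *
    ((Ioo 0 t).indicator g (s - q) * (Ioo 0 t).indicator w q)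

theorem integrable_triangleIntegrand (hf : IntegrableOn f (Ioo 0 t))
    (hg : IntegrableOn g (Ioo 0 t)) (hw : AEStronglyMeasurable w) (hM : ∀ q ∈ Ioo 0 t, |w q| ≤ M) :
    Integrable (Function.uncurry (triangleIntegrand f g w t)) (volume.prod volume) := by
  have hF := (integrable_indicator_iff measurableSet_Ioo).2 (integrableOn_comp_sub_left hf)
  have hG := ((integrable_indicator_iff measurableSet_Ioo).2 hg).comp_neg
  have hFG := (hF.convolution_integrand (ContinuousLinearMap.mul ℝ ℝ) hG).swap
  have hW : ∀ q, ‖(Ioo 0 t).indicator w q‖ ≤ max M 0 := fun q => by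
    by_cases hq : q ∈ Ioo 0 t
    · rw [indicator_of_mem hq]
      exact (hM q hq).trans (le_max_left _ _)
    · rw [indicator_of_notMem hq, norm_zero]
      exact le_max_right _ _
  refine (hFG.mul_bdd (c := max M 0) (hw.indicator measurableSet_Ioo).comp_snd
    (.of_forall fun p => hW p.2)).congr (.of_forall fun p => ?_)
  simp only [triangleIntegrand, Function.uncurry, Function.comp_apply, Prod.fst_swap, Prod.snd_swap,
    ContinuousLinearMap.mul_apply', neg_sub]
  ring

theorem integral_triangleIntegrand_right {s : ℝ} :
    ∫ q, triangleIntegrand f g w t s q =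
      (Ioo 0 t).indicator (fun s => f (t - s) * halfConv g w s) s := by
  simp only [triangleIntegrand, integral_const_mul]
  by_cases hs : s ∈ Ioo 0 t
  · rw [indicator_of_mem hs, indicator_of_mem hs, halfConv, ← integral_indicator measurableSet_Ioo]
    congr 2 with q
    by_cases hq : q ∈ Ioo 0 s
    · have hsq : s - q ∈ Ioo 0 t := ⟨sub_pos.2 hq.2, by linarith [hq.1, hs.2]⟩
      have hqt : q ∈ Ioo 0 t := ⟨hq.1, hq.2.trans hs.2⟩
      rw [indicator_of_mem hq, indicator_of_mem hqt, indicator_of_mem hsq]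
    · rw [indicator_of_notMem hq]
      simp only [mem_Ioo, not_and_or, not_lt] at hq
      rcases hq with hq | hq
      · rw [indicator_of_notMem (s := Ioo 0 t) (a := q) fun h => h.1.not_ge hq, mul_zero]
      · rw [indicator_of_notMem (s := Ioo 0 t) (a := s - q) fun h => h.1.not_ge (by linarith),
          zero_mul]
  · rw [indicator_of_notMem hs, indicator_of_notMem hs, zero_mul]

theorem integral_triangleIntegrand_left {q : ℝ} :
    ∫ s, triangleIntegrand f g w t s q =
      (Ioo 0 t).indicator (fun q => halfConv f g (t - q) * w q) q := by
  simp only [triangleIntegrand, ← mul_assoc, integral_mul_const]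
  by_cases hq : q ∈ Ioo 0 t
  · rw [indicator_of_mem hq, indicator_of_mem hq, halfConv_sub_eq_integral,
      ← integral_indicator measurableSet_Ioo]
    congr 2 with s
    by_cases hs : s ∈ Ioo q t
    · have hsq : s - q ∈ Ioo 0 t := ⟨sub_pos.2 hs.1, by linarith [hs.2, hq.1]⟩
      have hst : s ∈ Ioo 0 t := ⟨hq.1.trans hs.1, hs.2⟩
      rw [indicator_of_mem hs, indicator_of_mem hst, indicator_of_mem hsq]
    · rw [indicator_of_notMem hs]
      simp only [mem_Ioo, not_and_or, not_lt] at hs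
      rcases hs with hs | hs
      · rw [indicator_of_notMem (s := Ioo 0 t) (a := s - q) fun h => h.1.not_ge (by linarith),
          mul_zero]
      · rw [indicator_of_notMem (s := Ioo 0 t) (a := s) fun h => h.2.not_ge hs, zero_mul]
  · rw [indicator_of_notMem hq, indicator_of_notMem hq, mul_zero]

theorem integrableOn_mul_halfConv (hf : IntegrableOn f (Ioo 0 t)) (hg : IntegrableOn g (Ioo 0 t))
    (hw : AEStronglyMeasurable w) (hM : ∀ q ∈ Ioo 0 t, |w q| ≤ M) :
    IntegrableOn (fun s => f (t - s) * halfConv g w s) (Ioo 0 t) := by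
  have h := (integrable_triangleIntegrand hf hg hw hM).integral_prod_left
  simp only [Function.uncurry, integral_triangleIntegrand_right] at h
  exact (integrable_indicator_iff measurableSet_Ioo).1 h

theorem halfConv_assoc (hf : IntegrableOn f (Ioo 0 t)) (hg : IntegrableOn g (Ioo 0 t))
    (hw : AEStronglyMeasurable w) (hM : ∀ q ∈ Ioo 0 t, |w q| ≤ M) :
    halfConv f (halfConv g w) t = halfConv (halfConv f g) w t := by
  have h := integral_integral_swap (integrable_triangleIntegrand hf hg hw hM)
  simpa only [integral_triangleIntegrand_right, integral_triangleIntegrand_left,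
    integral_indicator measurableSet_Ioo, ← halfConv.eq_1] using h

end HalfConv

section FracKernel

variable {β γ x : ℝ}

/-- The Riemann–Liouville kernel `t^{β-1} / Γ(β)`: convolution with it is the fractional integral
of order `β`. -/
def fracKernel (β t : ℝ) : ℝ := (Real.Gamma β)⁻¹ * t ^ (β - 1)

theorem fracKernel_pos (hβ : 0 < β) (hx : 0 < x) : 0 < fracKernel β x :=
  mul_pos (inv_pos.2 (Real.Gamma_pos_of_pos hβ)) (Real.rpow_pos_of_pos hx _)

theorem fracKernel_one (x : ℝ) : fracKernel 1 x = 1 := by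
  simp [fracKernel]

theorem integrableOn_fracKernel (hβ : 0 < β) (T : ℝ) : IntegrableOn (fracKernel β) (Ioo 0 T) := by
  rcases le_or_gt T 0 with hT | hT
  · simp [Ioo_eq_empty (not_lt.2 hT)]
  · exact ((intervalIntegral.integrableOn_Ioo_rpow_iff hT).2 (by linarith)).const_mul _

theorem halfConv_fracKernel (hβ : 0 < β) (hγ : 0 < γ) (hx : 0 < x) :
    halfConv (fracKernel β) (fracKernel γ) x = fracKernel (β + γ) x := by
  have hbeta : ∫ q in Ioo 0 x, (x - q) ^ (β - 1) * q ^ (γ - 1) =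
      x ^ (β + γ - 1) * (Real.Gamma β * Real.Gamma γ / Real.Gamma (β + γ)) := by
    have h := Complex.betaIntegral_scaled (γ : ℂ) (β : ℂ) hx
    rw [Complex.betaIntegral_eq_Gamma_mul_div _ _ (by simpa) (by simpa),
      intervalIntegral.integral_of_le hx.le, integral_Ioc_eq_integral_Ioo,
      setIntegral_congr_fun (g := fun q => (((x - q) ^ (β - 1) * q ^ (γ - 1) : ℝ) : ℂ))
        measurableSet_Ioo, integral_complex_ofReal] at h
    · rw [← Complex.ofReal_add, Complex.Gamma_ofReal, Complex.Gamma_ofReal, Complex.Gamma_ofReal,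
        ← Complex.ofReal_one, ← Complex.ofReal_sub, ← Complex.ofReal_cpow hx.le] at h
      rw [add_comm β, mul_comm (Real.Gamma β)]
      exact_mod_cast h
    · intro q hq
      change _ = (((x - q) ^ (β - 1) * q ^ (γ - 1) : ℝ) : ℂ)
      rw [Complex.ofReal_mul, Complex.ofReal_cpow hq.1.le, Complex.ofReal_cpow (by linarith [hq.2])]
      push_cast
      ring
  have hGβ := (Real.Gamma_pos_of_pos hβ).ne'
  have hGγ := (Real.Gamma_pos_of_pos hγ).ne'
  calc halfConv (fracKernel β) (fracKernel γ) x
      = (Real.Gamma β)⁻¹ * (Real.Gamma γ)⁻¹ *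
          ∫ q in Ioo 0 x, (x - q) ^ (β - 1) * q ^ (γ - 1) := by
        rw [halfConv, ← integral_const_mul]
        congr 1 with q
        simp only [fracKernel]
        ring
    _ = fracKernel (β + γ) x := by
        rw [hbeta, fracKernel]
        field_simp

theorem integrableOn_fracKernel_mul (hβ : 0 < β) (hγ : 0 < γ) (hx : 0 < x) :
    IntegrableOn (fun q => fracKernel β (x - q) * fracKernel γ q) (Ioo 0 x) := by
  refine not_imp_comm.1 integral_undef (ne_of_gt ?_)
  exact (fracKernel_pos (add_pos hβ hγ) hx).trans_eq (halfConv_fracKernel hβ hγ hx).symm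

end FracKernel

section MittagLeffler

variable {α β x : ℝ}

theorem rpow_mul_exp_le_Gamma {R y : ℝ} (hR : 0 < R) (hy : 1 ≤ y) :
    R ^ y * Real.exp (-(2 * R)) ≤ Real.Gamma y := by
  have hint := Real.GammaIntegral_convergent (s := y) (by linarith)
  rw [Real.Gamma_eq_integral (by linarith)]
  calc R ^ y * Real.exp (-(2 * R))
      = ∫ _ in Ioc R (2 * R), Real.exp (-(2 * R)) * R ^ (y - 1) := by
        rw [setIntegral_const, smul_eq_mul, Measure.real, Real.volume_Ioc,
          ENNReal.toReal_ofReal (by linarith), Real.rpow_sub_one hR.ne']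
        field_simp
        norm_num
    _ ≤ ∫ x in Ioc R (2 * R), Real.exp (-x) * x ^ (y - 1) := by
        refine setIntegral_mono_on (integrableOn_const measure_Ioc_lt_top.ne)
          (hint.mono_set fun x hx => hR.trans hx.1) measurableSet_Ioc fun x hx => ?_
        have := hx.1
        have := hx.2
        gcongr
    _ ≤ ∫ x in Ioi 0, Real.exp (-x) * x ^ (y - 1) := by
        refine setIntegral_mono_set hint ?_ (.of_forall fun x hx => hR.trans hx.1)
        filter_upwards [ae_restrict_mem measurableSet_Ioi] with x hx
        exact mul_nonneg (Real.exp_pos _).le (Real.rpow_nonneg (le_of_lt hx) _)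

theorem summable_mittagLeffler (hα : 0 < α) (hβ : 0 < β) (z : ℝ) :
    Summable fun k : ℕ => (Real.Gamma (α * k + β))⁻¹ * z ^ k := by
  set y : ℝ := 2 * |z| + 2
  have hy0 : 0 < y := by positivity
  set R : ℝ := y ^ α⁻¹
  have hR : 0 < R := by positivity
  have hRα : R ^ α = y := Real.rpow_inv_rpow hy0.le hα.ne'
  have hgeo : Summable fun k : ℕ => (R ^ β * Real.exp (-(2 * R)))⁻¹ * (1 / 2 : ℝ) ^ k :=
    (summable_geometric_of_lt_one (by norm_num) (by norm_num)).mul_left _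
  obtain ⟨N, hN⟩ := exists_nat_ge (1 / α)
  refine Summable.of_norm_bounded_eventually_nat hgeo ?_
  filter_upwards [eventually_ge_atTop N] with k hk
  have hk1 : 1 ≤ α * k + β := by
    have : 1 ≤ α * k := (div_le_iff₀' hα).1 (hN.trans (by exact_mod_cast hk))
    linarith
  have hΓ := rpow_mul_exp_le_Gamma hR hk1
  have hG : 0 < Real.Gamma (α * k + β) := Real.Gamma_pos_of_pos (by linarith)
  rw [norm_mul, norm_inv, norm_pow, Real.norm_eq_abs, Real.norm_eq_abs, abs_of_pos hG]
  rw [Real.rpow_add hR, Real.rpow_mul hR.le, hRα, Real.rpow_natCast] at hΓ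
  calc (Real.Gamma (α * k + β))⁻¹ * |z| ^ k
      ≤ (y ^ k * R ^ β * Real.exp (-(2 * R)))⁻¹ * |z| ^ k := by gcongr
    _ = (R ^ β * Real.exp (-(2 * R)))⁻¹ * (|z| / y) ^ k := by
        rw [div_pow]; field_simp
    _ ≤ _ := by
        refine mul_le_mul_of_nonneg_left (pow_le_pow_left₀ (by positivity) ?_ k) (by positivity)
        rw [div_le_iff₀ hy0]
        linarith [abs_nonneg z]

theorem continuous_mittagLeffler (hα : 0 < α) (hβ : 0 < β) : Continuous (mittagLeffler α β) := by
  refine continuous_iff_continuousAt.2 fun z => ?_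
  have hnhds : Metric.ball (0 : ℝ) (|z| + 1) ∈ 𝓝 z :=
    Metric.isOpen_ball.mem_nhds (by simp)
  refine ContinuousOn.continuousAt ?_ hnhds
  refine continuousOn_tsum (fun k => by fun_prop) (summable_mittagLeffler hα hβ (|z| + 1)) ?_
  intro k y hy
  have hG : 0 < Real.Gamma (α * k + β) := Real.Gamma_pos_of_pos (by positivity)
  rw [norm_mul, norm_inv, norm_pow, Real.norm_eq_abs, Real.norm_eq_abs, abs_of_pos hG]
  have : |y| ≤ |z| + 1 := by simpa using (Metric.mem_ball.1 hy).le
  gcongr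

theorem mittagLeffler_one_add (hα : 0 < α) (z : ℝ) :
    mittagLeffler α 1 z = 1 + z * mittagLeffler α (α + 1) z := by
  rw [mittagLeffler, (summable_mittagLeffler hα one_pos z).tsum_eq_zero_add, mittagLeffler,
    ← tsum_mul_left]
  congr 1
  · simp
  · refine tsum_congr fun k => ?_
    push_cast
    rw [show α * (k + 1) + 1 = α * k + (α + 1) by ring]
    ring

theorem hasSum_fracKernel (hα : 0 < α) (hβ : 0 < β) (z : ℝ) (hx : 0 < x) :
    HasSum (fun k : ℕ => z ^ k * fracKernel (α * k + β) x)
      (x ^ (β - 1) * mittagLeffler α β (z * x ^ α)) := by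
  have hterm : ∀ k : ℕ, z ^ k * fracKernel (α * k + β) x =
      x ^ (β - 1) * ((Real.Gamma (α * k + β))⁻¹ * (z * x ^ α) ^ k) := fun k => by
    have hpow : x ^ (α * k + β - 1) = x ^ (β - 1) * (x ^ α) ^ k := by
      rw [← Real.rpow_natCast, ← Real.rpow_mul hx.le, ← Real.rpow_add hx]
      congr 1
      ring
    rw [fracKernel, hpow, mul_pow]
    ring
  simp only [hterm]
  exact (summable_mittagLeffler hα hβ (z * x ^ α)).hasSum.mul_left _

end MittagLeffler

section ResolventKernel

variable {α β lam x : ℝ}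

/-- The kernel `t^{α-1} E_{α,α}(-λ t^α)` of the inverse of `D_t^α + λ`. -/
def resolventKernel (α lam t : ℝ) : ℝ :=
  t ^ (α - 1) * mittagLeffler α α (-lam * t ^ α)

theorem continuousOn_resolventKernel (hα : 0 < α) (lam : ℝ) :
    ContinuousOn (resolventKernel α lam) (Ioi 0) := by
  have hpow : ∀ p : ℝ, ContinuousOn (fun t : ℝ => t ^ p) (Ioi 0) := fun p =>
    continuousOn_id.rpow_const fun t ht => Or.inl (ne_of_gt ht)
  exact (hpow _).mul ((continuous_mittagLeffler hα hα).comp_continuousOn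
    (continuousOn_const.mul (hpow α)))

theorem exists_abs_resolventKernel_le (hα : 0 < α) (lam T : ℝ) :
    ∃ C, ∀ q ∈ Ioo 0 T, |resolventKernel α lam q| ≤ C * fracKernel α q := by
  have hc : Continuous fun t : ℝ => mittagLeffler α α (-lam * t ^ α) :=
    (continuous_mittagLeffler hα hα).comp
      (continuous_const.mul (continuous_id.rpow_const fun _ => Or.inr hα.le))
  obtain ⟨C, hC⟩ := isCompact_Icc.exists_bound_of_continuousOn (s := Icc 0 T) hc.continuousOn
  refine ⟨C * Real.Gamma α, fun q hq => ?_⟩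
  have hq0 := Real.rpow_pos_of_pos hq.1 (α - 1)
  calc |resolventKernel α lam q| = q ^ (α - 1) * |mittagLeffler α α (-lam * q ^ α)| := by
        rw [resolventKernel, abs_mul, abs_of_pos hq0]
    _ ≤ q ^ (α - 1) * C := by gcongr; exact hC q ⟨hq.1.le, hq.2.le⟩
    _ = C * Real.Gamma α * fracKernel α q := by
        rw [fracKernel, mul_assoc, mul_inv_cancel_left₀ (Real.Gamma_pos_of_pos hα).ne', mul_comm]

theorem integrableOn_resolventKernel (hα : 0 < α) (lam T : ℝ) :
    IntegrableOn (resolventKernel α lam) (Ioo 0 T) := by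
  obtain ⟨C, hC⟩ := exists_abs_resolventKernel_le hα lam T
  refine ((integrableOn_fracKernel hα T).const_mul C).mono' (((continuousOn_resolventKernel hα
    lam).mono fun q hq => hq.1).aestronglyMeasurable measurableSet_Ioo) ?_
  filter_upwards [ae_restrict_mem measurableSet_Ioo] with q hq using hC q hq

theorem integrableOn_fracKernel_mul_resolventKernel (hα : 0 < α) (hβ : 0 < β) (lam : ℝ)
    (hx : 0 < x) :
    IntegrableOn (fun q => fracKernel β (x - q) * resolventKernel α lam q) (Ioo 0 x) := by
  obtain ⟨C, hC⟩ := exists_abs_resolventKernel_le hα lam x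
  refine ((integrableOn_fracKernel_mul hβ hα hx).const_mul C).mono'
    ((integrableOn_comp_sub_left (integrableOn_fracKernel hβ x)).aestronglyMeasurable.mul
      (integrableOn_resolventKernel hα lam x).aestronglyMeasurable) ?_
  filter_upwards [ae_restrict_mem measurableSet_Ioo] with q hq
  have hβq := fracKernel_pos hβ (sub_pos.2 hq.2)
  rw [norm_mul, Real.norm_eq_abs, Real.norm_eq_abs, abs_of_pos hβq]
  calc fracKernel β (x - q) * |resolventKernel α lam q|
      ≤ fracKernel β (x - q) * (C * fracKernel α q) := by gcongr; exact hC q hq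
    _ = C * (fracKernel β (x - q) * fracKernel α q) := by ring

theorem halfConv_fracKernel_resolventKernel (hα : 0 < α) (hβ : 0 < β) (lam : ℝ) (hx : 0 < x) :
    halfConv (fracKernel β) (resolventKernel α lam) x =
      x ^ (β + α - 1) * mittagLeffler α (β + α) (-lam * x ^ α) := by
  let F (z : ℝ) (k : ℕ) (q : ℝ) : ℝ := z ^ k * (fracKernel β (x - q) * fracKernel (α * k + α) q)
  have hαk : ∀ k : ℕ, 0 < α * k + α := fun k => by positivity
  have hint : ∀ z k, ∫ q in Ioo 0 x, F z k q = z ^ k * fracKernel (α * k + (β + α)) x :=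
    fun z k => by
      rw [integral_const_mul, ← halfConv.eq_1, halfConv_fracKernel hβ (hαk k) hx, add_left_comm]
  have hnorm : ∀ k, ∫ q in Ioo 0 x, ‖F (-lam) k q‖ = ∫ q in Ioo 0 x, F |lam| k q := fun k =>
    setIntegral_congr_fun measurableSet_Ioo fun q hq => by
      have hβq := fracKernel_pos hβ (sub_pos.2 hq.2)
      have hαq := fracKernel_pos (hαk k) hq.1
      simp only [F, norm_mul, norm_pow, norm_neg, Real.norm_eq_abs, abs_of_pos hβq, abs_of_pos hαq]
  have hsum := hasSum_integral_of_summable_integral_norm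
    (F := F (-lam)) (μ := volume.restrict (Ioo 0 x))
    (fun k => (integrableOn_fracKernel_mul hβ (hαk k) hx).const_mul _) (by
      simp only [hnorm, hint]
      exact (hasSum_fracKernel hα (add_pos hβ hα) |lam| hx).summable)
  simp only [hint] at hsum
  rw [← hsum.unique (hasSum_fracKernel hα (add_pos hβ hα) (-lam) hx)]
  refine setIntegral_congr_fun measurableSet_Ioo fun q hq => ?_
  rw [resolventKernel, ← (hasSum_fracKernel hα hα (-lam) hq.1).tsum_eq, ← tsum_mul_left]
  exact tsum_congr fun k => by ring

theorem barrierR₀_eq_fracKernel (α lam x : ℝ) :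
    barrierR₀ α lam x = fracKernel (1 - α) x + lam * fracKernel 1 x := by
  rw [fracKernel_one, mul_one, barrierR₀, fracKernel, show 1 - α - 1 = -α by ring]

theorem integrableOn_barrierR₀ (hα : α < 1) (lam T : ℝ) :
    IntegrableOn (barrierR₀ α lam) (Ioo 0 T) :=
  IntegrableOn.congr_fun ((integrableOn_fracKernel (sub_pos.2 hα) T).add
      ((integrableOn_fracKernel one_pos T).const_mul lam))
    (fun x _ => (barrierR₀_eq_fracKernel α lam x).symm) measurableSet_Ioo

theorem halfConv_barrierR₀_resolventKernel (hα : α ∈ Ioo (0 : ℝ) 1) (lam : ℝ) (hx : 0 < x) :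
    halfConv (barrierR₀ α lam) (resolventKernel α lam) x = 1 := by
  have hβ : 0 < 1 - α := sub_pos.2 hα.2
  calc halfConv (barrierR₀ α lam) (resolventKernel α lam) x
      = halfConv (fracKernel (1 - α)) (resolventKernel α lam) x +
          lam * halfConv (fracKernel 1) (resolventKernel α lam) x := by
        simp only [halfConv, barrierR₀_eq_fracKernel, add_mul, mul_assoc]
        rw [integral_add (integrableOn_fracKernel_mul_resolventKernel hα.1 hβ lam hx)
          ((integrableOn_fracKernel_mul_resolventKernel hα.1 one_pos lam hx).const_mul lam),
          integral_const_mul]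
    _ = mittagLeffler α 1 (-lam * x ^ α) + lam * (x ^ α * mittagLeffler α (α + 1) _) := by
        rw [halfConv_fracKernel_resolventKernel hα.1 hβ lam hx,
          halfConv_fracKernel_resolventKernel hα.1 one_pos lam hx]
        rw [sub_add_cancel, sub_self, Real.rpow_zero, one_mul, add_sub_cancel_left, add_comm 1 α]
    _ = 1 := by
        rw [mittagLeffler_one_add hα.1]
        ring

end ResolventKernel

section Caputo

variable {α lam δ ε t C M T : ℝ} {K : ℝ≥0} {v w z : ℝ → ℝ}

theorem integrableOn_sub_rpow_neg (hα : α < 1) (t : ℝ) :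
    IntegrableOn (fun s : ℝ => (t - s) ^ (-α)) (Ioo 0 t) := by
  rcases le_or_gt t 0 with ht | ht
  · simp [Ioo_eq_empty (not_lt.2 ht)]
  · exact integrableOn_comp_sub_left (f := fun s => s ^ (-α))
      ((intervalIntegral.integrableOn_Ioo_rpow_iff ht).2 (by linarith))

theorem abs_caputoIntegrand_le {s : ℝ} (hs : s < t) (h : |v t - v s| ≤ C * (t - s)) :
    |caputoIntegrand α v t s| ≤ C * (t - s) ^ (-α) := by
  have hts : 0 < t - s := sub_pos.2 hs
  rw [caputoIntegrand, abs_mul, abs_of_pos (Real.rpow_pos_of_pos hts _)]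
  calc (t - s) ^ (-α - 1) * |v t - v s| ≤ (t - s) ^ (-α - 1) * (C * (t - s)) := by gcongr
    _ = C * ((t - s) ^ (-α - 1) * (t - s)) := by ring
    _ = C * (t - s) ^ (-α) := by rw [← Real.rpow_add_one hts.ne', sub_add_cancel]

theorem hasCaputo_of_abs_sub_le (hα : α < 1) (hv : ContinuousOn v (Ioo 0 t))
    (h : ∀ s ∈ Ioo 0 t, |v t - v s| ≤ C * (t - s)) : HasCaputo α v t := by
  have hcont : ContinuousOn (caputoIntegrand α v t) (Ioo 0 t) :=
    (ContinuousOn.rpow_const (by fun_prop) fun _ hs => Or.inl (sub_pos.2 hs.2).ne').mul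
      (continuousOn_const.sub hv)
  refine ((integrableOn_sub_rpow_neg hα t).const_mul C).mono'
    (hcont.aestronglyMeasurable measurableSet_Ioo) ?_
  filter_upwards [ae_restrict_mem measurableSet_Ioo] with s hs
  exact abs_caputoIntegrand_le hs.2 (h s hs)

theorem abs_sub_le_of_lipschitzOn (hε : ε < t) (hM : ∀ s ∈ Icc 0 t, |v s| ≤ M)
    (hK : LipschitzOnWith K v (Icc ε t)) :
    ∀ s ∈ Icc 0 t, |v t - v s| ≤ (K + 2 * M / (t - ε)) * (t - s) := by
  intro s hs
  have hM0 : 0 ≤ M := (abs_nonneg _).trans (hM s hs)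
  have hε' : 0 < t - ε := sub_pos.2 hε
  have hts : 0 ≤ t - s := by linarith [hs.2]
  rcases le_or_gt ε s with h | h
  · calc |v t - v s| ≤ K * |t - s| := hK.dist_le_mul t ⟨hε.le, le_rfl⟩ s ⟨h, hs.2⟩
      _ = K * (t - s) := by rw [abs_of_nonneg hts]
      _ ≤ (K + 2 * M / (t - ε)) * (t - s) := by
        gcongr
        exact le_add_of_nonneg_right (by positivity)
  · calc |v t - v s| ≤ |v t| + |v s| := abs_sub _ _
      _ ≤ 2 * M := by linarith [hM s hs, hM t ⟨hs.1.trans hs.2, le_rfl⟩]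
      _ = 2 * M / (t - ε) * (t - ε) := by field_simp
      _ ≤ 2 * M / (t - ε) * (t - s) := by gcongr
      _ ≤ (K + 2 * M / (t - ε)) * (t - s) := by
        gcongr
        exact le_add_of_nonneg_left K.2

theorem hasCaputo_of_lipschitzOn (hα : α < 1) (hv : ContinuousOn v (Icc 0 t)) (hε : ε < t)
    (hK : LipschitzOnWith K v (Icc ε t)) : HasCaputo α v t := by
  obtain ⟨M, hM⟩ := isCompact_Icc.exists_bound_of_continuousOn hv
  exact hasCaputo_of_abs_sub_le hα (hv.mono Ioo_subset_Icc_self) fun s hs =>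
    abs_sub_le_of_lipschitzOn hε hM hK s (Ioo_subset_Icc_self hs)

theorem caputo_sub (hv : HasCaputo α v t) (hw : HasCaputo α w t) :
    caputo α (fun s => v s - w s) t = caputo α v t - caputo α w t := by
  have hint : caputoIntegrand α (fun s => v s - w s) t =
      fun s => caputoIntegrand α v t s - caputoIntegrand α w t s := by
    ext s
    simp only [caputoIntegrand]
    ring
  simp only [caputo]
  rw [hint, integral_sub hv hw]
  ring

theorem caputoIntegrand_const_mul (α : ℝ) (v : ℝ → ℝ) (C t : ℝ) :
    caputoIntegrand α (fun s => C * v s) t = fun s => C * caputoIntegrand α v t s := by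
  ext s
  simp only [caputoIntegrand]
  ring

theorem HasCaputo.const_mul (hv : HasCaputo α v t) (C : ℝ) :
    HasCaputo α (fun s => C * v s) t := by
  rw [HasCaputo, caputoIntegrand_const_mul]
  exact Integrable.const_mul hv C

theorem caputo_const_mul (α : ℝ) (v : ℝ → ℝ) (C t : ℝ) :
    caputo α (fun s => C * v s) t = C * caputo α v t := by
  simp only [caputo, caputoIntegrand_const_mul, integral_const_mul]
  ring

theorem inv_Gamma_one_sub_pos (hα : α < 1) : 0 < (Real.Gamma (1 - α))⁻¹ :=
  inv_pos.2 (Real.Gamma_pos_of_pos (sub_pos.2 hα))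

theorem caputo_le_caputo (hα : α ∈ Ioo (0 : ℝ) 1) (ht : 0 < t) (hv : HasCaputo α v t)
    (hw : HasCaputo α w t) (h : ∀ s ∈ Ico 0 t, v t - v s ≤ w t - w s) :
    caputo α v t ≤ caputo α w t := by
  have h0 := h 0 ⟨le_rfl, ht⟩
  have hI : ∫ s in Ioo 0 t, caputoIntegrand α v t s ≤ ∫ s in Ioo 0 t, caputoIntegrand α w t s :=
    setIntegral_mono_on hv hw measurableSet_Ioo fun s hs =>
      mul_le_mul_of_nonneg_left (h s ⟨hs.1.le, hs.2⟩) (Real.rpow_nonneg (sub_pos.2 hs.2).le _)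
  have := hα.1
  have := inv_Gamma_one_sub_pos hα.2
  simp only [caputo]
  gcongr

theorem integral_caputoIntegrand_nonpos (h : ∀ s ∈ Ioo 0 t, v t ≤ v s) :
    ∫ s in Ioo 0 t, caputoIntegrand α v t s ≤ 0 :=
  setIntegral_nonpos measurableSet_Ioo fun s hs =>
    mul_nonpos_of_nonneg_of_nonpos (Real.rpow_nonneg (sub_pos.2 hs.2).le _) (sub_nonpos.2 (h s hs))

theorem caputo_nonpos_of_forall_le (hα : α ∈ Ioo (0 : ℝ) 1) (ht : 0 < t)
    (h : ∀ s ∈ Ico 0 t, v t ≤ v s) : caputo α v t ≤ 0 := by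
  have hI : ∫ s in Ioo 0 t, caputoIntegrand α v t s ≤ 0 :=
    integral_caputoIntegrand_nonpos fun s hs => h s (Ioo_subset_Ico_self hs)
  have hjump : t ^ (-α) * (v t - v 0) ≤ 0 :=
    mul_nonpos_of_nonneg_of_nonpos (Real.rpow_nonneg ht.le _) (sub_nonpos.2 (h 0 ⟨le_rfl, ht⟩))
  exact mul_nonpos_of_nonneg_of_nonpos (inv_Gamma_one_sub_pos hα.2).le
    (add_nonpos hjump (mul_nonpos_of_nonneg_of_nonpos hα.1.le hI))

theorem caputo_neg_of_lt_of_forall_le (hα : α ∈ Ioo (0 : ℝ) 1) (ht : 0 < t) (h0 : z t < z 0)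
    (h : ∀ s ∈ Ioo 0 t, z t ≤ z s) : caputo α z t < 0 := by
  have hI : ∫ s in Ioo 0 t, caputoIntegrand α z t s ≤ 0 := integral_caputoIntegrand_nonpos h
  have hjump : t ^ (-α) * (z t - z 0) < 0 :=
    mul_neg_of_pos_of_neg (Real.rpow_pos_of_pos ht _) (sub_neg.2 h0)
  exact mul_neg_of_pos_of_neg (inv_Gamma_one_sub_pos hα.2)
    (add_neg_of_neg_of_nonpos hjump (mul_nonpos_of_nonneg_of_nonpos hα.1.le hI))

theorem tendsto_nhdsGT_zero_of_continuousOn (hT : 0 < T) (hv : ContinuousOn v (Icc 0 T)) :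
    Tendsto v (𝓝[>] 0) (𝓝 (v 0)) :=
  (hv 0 ⟨le_rfl, hT.le⟩).mono_of_mem_nhdsWithin (Icc_mem_nhdsGT hT)

theorem nonneg_of_caputo_add_nonneg (hα : α ∈ Ioo (0 : ℝ) 1) (hlam : 0 ≤ lam)
    (hz : ContinuousOn z (Ioc 0 T)) (hz0 : 0 ≤ z 0) (hz0' : ∀ ε > 0, ∀ᶠ s in 𝓝[>] 0, -ε < z s)
    (h : ∀ t ∈ Ioc 0 T, 0 ≤ caputo α z t + lam * z t) : ∀ t ∈ Ioc 0 T, 0 ≤ z t := by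
  intro t₁ ht₁
  by_contra! hneg
  obtain ⟨η, hη, hηz⟩ := mem_nhdsGT_iff_exists_Ioo_subset.1 (hz0' (-z t₁) (by linarith))
  have hη : 0 < η := hη
  have hηz : ∀ s ∈ Ioo 0 η, z t₁ < z s := fun s hs => by simpa using hηz hs
  have hηt : η ≤ t₁ := by
    by_contra! hlt
    exact lt_irrefl _ (hηz t₁ ⟨ht₁.1, hlt⟩)
  obtain ⟨t₀, ht₀, hmin⟩ := isCompact_Icc.exists_isMinOn (s := Icc η T) (f := z)
    ⟨t₁, hηt, ht₁.2⟩ (hz.mono fun s hs => ⟨hη.trans_le hs.1, hs.2⟩)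
  have ht₀' : t₀ ∈ Ioc 0 T := ⟨hη.trans_le ht₀.1, ht₀.2⟩
  have hle : z t₀ ≤ z t₁ := hmin ⟨hηt, ht₁.2⟩
  have hcaputo : caputo α z t₀ < 0 :=
    caputo_neg_of_lt_of_forall_le hα ht₀'.1 (by linarith) fun s hs => by
      rcases lt_or_ge s η with hs' | hs'
      · exact hle.trans (hηz s ⟨hs.1, hs'⟩).le
      · exact hmin ⟨hs', hs.2.le.trans ht₀.2⟩
  have hlz : lam * z t₀ ≤ 0 := mul_nonpos_of_nonneg_of_nonpos hlam (by linarith)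
  linarith [h t₀ ht₀']

theorem integral_mul_sub_rpow (hα : α ≠ 0) (hδ : 0 ≤ δ) (hδt : δ < t) :
    α * ∫ s in Ioc 0 δ, (t - s) ^ (-α - 1) = (t - δ) ^ (-α) - t ^ (-α) := by
  have hδt' : 0 < t - δ := sub_pos.2 hδt
  rw [← intervalIntegral.integral_of_le hδ,
    intervalIntegral.integral_comp_sub_left (fun x => x ^ (-α - 1)) t, sub_zero,
    integral_rpow (Or.inr ⟨by simpa, fun h0 => ?_⟩), sub_add_cancel]
  · field_simp
    ring
  · rw [uIcc_of_le (by linarith)] at h0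
    exact hδt'.not_ge h0.1

/-- The function `v` started at time `δ` instead of `0`. -/
def delay (δ : ℝ) (v : ℝ → ℝ) (s : ℝ) : ℝ := v (max (s - δ) 0)

theorem delay_of_le {s : ℝ} (h : s ≤ δ) : delay δ v s = v 0 := by
  rw [delay, max_eq_right (by linarith)]

theorem delay_of_ge {s : ℝ} (h : δ ≤ s) : delay δ v s = v (s - δ) := by
  rw [delay, max_eq_left (by linarith)]

theorem caputoIntegrand_delay_of_le (h : t ≤ δ) :
    EqOn (caputoIntegrand α (delay δ v) t) 0 (Ioo 0 t) := fun s hs => by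
  simp [caputoIntegrand, delay_of_le h, delay_of_le (hs.2.le.trans h)]

theorem hasCaputo_delay_of_le (h : t ≤ δ) : HasCaputo α (delay δ v) t :=
  integrableOn_zero.congr_fun (caputoIntegrand_delay_of_le h).symm measurableSet_Ioo

theorem caputo_delay_of_le (hδ : 0 ≤ δ) (h : t ≤ δ) : caputo α (delay δ v) t = 0 := by
  rw [caputo, delay_of_le h, delay_of_le hδ,
    setIntegral_congr_fun measurableSet_Ioo (caputoIntegrand_delay_of_le h)]
  simp

theorem caputoIntegrand_delay_left (hδt : δ < t) :
    EqOn (caputoIntegrand α (delay δ v) t)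
      (fun s => (t - s) ^ (-α - 1) * (v (t - δ) - v 0)) (Ioc 0 δ) := fun s hs => by
  simp only [caputoIntegrand, delay_of_ge hδt.le, delay_of_le hs.2]

theorem caputoIntegrand_delay_right (hδt : δ < t) :
    EqOn (caputoIntegrand α (delay δ v) t)
      (caputoIntegrand α v (t - δ) ∘ (· - δ)) (Ioo δ t) := fun s hs => by
  simp only [caputoIntegrand, delay_of_ge hδt.le, delay_of_ge hs.1.le, Function.comp_apply,
    sub_sub_sub_cancel_right]

theorem integrableOn_caputoIntegrand_delay_left (hδt : δ < t) :
    IntegrableOn (caputoIntegrand α (delay δ v) t) (Ioc 0 δ) := by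
  refine IntegrableOn.congr_fun ?_ (caputoIntegrand_delay_left hδt).symm measurableSet_Ioc
  refine (ContinuousOn.integrableOn_Icc ?_).mono_set Ioc_subset_Icc_self
  exact (ContinuousOn.rpow_const (by fun_prop) fun s hs =>
    Or.inl (sub_pos.2 (hs.2.trans_lt hδt)).ne').mul continuousOn_const

theorem integrableOn_caputoIntegrand_delay_right (hδt : δ < t) (hv : HasCaputo α v (t - δ)) :
    IntegrableOn (caputoIntegrand α (delay δ v) t) (Ioo δ t) := by
  refine IntegrableOn.congr_fun ?_ (caputoIntegrand_delay_right hδt).symm measurableSet_Ioo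
  have h := ((measurePreserving_sub_right volume δ).integrableOn_comp_preimage
    (MeasurableEquiv.subRight δ).measurableEmbedding).2 hv
  rwa [preimage_sub_const_Ioo, zero_add, sub_add_cancel] at h

theorem hasCaputo_delay (hδ : 0 ≤ δ) (hδt : δ < t) (hv : HasCaputo α v (t - δ)) :
    HasCaputo α (delay δ v) t := by
  rw [HasCaputo, ← Ioc_union_Ioo_eq_Ioo hδ hδt]
  exact (integrableOn_caputoIntegrand_delay_left hδt).union
    (integrableOn_caputoIntegrand_delay_right hδt hv)

theorem caputo_delay (hα : α ≠ 0) (hδ : 0 ≤ δ) (hδt : δ < t) (hv : HasCaputo α v (t - δ)) :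
    caputo α (delay δ v) t = caputo α v (t - δ) := by
  have hleft : α * ∫ s in Ioc 0 δ, caputoIntegrand α (delay δ v) t s =
      ((t - δ) ^ (-α) - t ^ (-α)) * (v (t - δ) - v 0) := by
    rw [setIntegral_congr_fun measurableSet_Ioc (caputoIntegrand_delay_left hδt),
      integral_mul_const, ← mul_assoc, integral_mul_sub_rpow hα hδ hδt]
  have hright : ∫ s in Ioo δ t, caputoIntegrand α (delay δ v) t s =
      ∫ s in Ioo 0 (t - δ), caputoIntegrand α v (t - δ) s := by
    rw [setIntegral_congr_fun measurableSet_Ioo (caputoIntegrand_delay_right hδt)]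
    have h := (measurePreserving_sub_right volume δ).setIntegral_preimage_emb
      (MeasurableEquiv.subRight δ).measurableEmbedding (caputoIntegrand α v (t - δ))
      (Ioo 0 (t - δ))
    rwa [preimage_sub_const_Ioo, zero_add, sub_add_cancel] at h
  rw [caputo, caputo, ← Ioc_union_Ioo_eq_Ioo hδ hδt,
    setIntegral_union (disjoint_left.2 fun s hs hs' => hs'.1.not_ge hs.2) measurableSet_Ioo
      (integrableOn_caputoIntegrand_delay_left hδt)
      (integrableOn_caputoIntegrand_delay_right hδt hv),
    mul_add α, hleft, hright, delay_of_ge hδt.le, delay_of_le hδ]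
  ring

end Caputo

section Representation

variable {α lam t T : ℝ} {K : ℝ≥0} {v : ℝ → ℝ}

theorem caputo_add_eq_halfConv (hα : α ∈ Ioo (0 : ℝ) 1) (ht : 0 < t)
    (hv : ContinuousOn v (Icc 0 t)) (hlip : ∀ ε ∈ Ioo 0 t, ∃ K : ℝ≥0, LipschitzOnWith K v (Icc ε t))
    (hd : IntegrableOn (deriv v) (Ioo 0 t)) (hprim : ∫ s in Ioo 0 t, deriv v s = v t)
    (hfrac : IntegrableOn (fun s => fracKernel (1 - α) (t - s) * deriv v s) (Ioo 0 t)) :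
    caputo α v t + lam * v t = halfConv (barrierR₀ α lam) (deriv v) t := by
  have hG := (inv_Gamma_one_sub_pos hα.2).ne'
  have hpow : ∀ s, fracKernel (1 - α) (t - s) * deriv v s =
      (Real.Gamma (1 - α))⁻¹ * ((t - s) ^ (-α) * deriv v s) := fun s => by
    rw [fracKernel, mul_assoc, show 1 - α - 1 = -α by ring]
  have hv0 : Tendsto v (𝓝[>] 0) (𝓝 (v 0)) := by
    rw [← nhdsWithin_Ioo_eq_nhdsGT ht]
    exact (hv 0 ⟨le_rfl, ht.le⟩).mono_left (nhdsWithin_mono 0 Ioo_subset_Icc_self)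
  simp only [hpow] at hfrac
  rw [caputo_eq_integral_deriv hα ht hv0 hlip ((integrable_const_mul_iff (.mk0 _ hG) _).1 hfrac),
    ← integral_const_mul, ← hprim, ← integral_const_mul, ← integral_add hfrac (hd.const_mul _)]
  congr 1 with s
  rw [barrierR₀_eq_fracKernel, fracKernel_one, add_mul, hpow, mul_one]

theorem integral_deriv_of_lipschitzOn (ht : 0 ≤ t) (hv0 : v 0 = 0)
    (hv : LipschitzOnWith K v (Icc 0 t)) : ∫ s in Ioo 0 t, deriv v s = v t := by
  have h := (LipschitzOnWith.absolutelyContinuousOnInterval (f := v) (a := 0) (b := t) (K := K)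
    (by rwa [uIcc_of_le ht])).integral_deriv_eq_sub
  rwa [intervalIntegral.integral_of_le ht, integral_Ioc_eq_integral_Ioo, hv0, sub_zero] at h

theorem abs_deriv_le_of_lipschitzOn {s : ℝ} (hv : LipschitzOnWith K v (Icc 0 t))
    (hs : s ∈ Ioo 0 t) : |deriv v s| ≤ K :=
  norm_deriv_le_of_lipschitzOn (Icc_mem_nhds hs.1 hs.2) hv

theorem caputo_add_eq_halfConv_of_lipschitzOn (hα : α ∈ Ioo (0 : ℝ) 1) (ht : 0 < t)
    (hv0 : v 0 = 0) (hv : LipschitzOnWith K v (Icc 0 t)) :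
    caputo α v t + lam * v t = halfConv (barrierR₀ α lam) (deriv v) t := by
  have hmeas := (measurable_deriv v).aestronglyMeasurable (μ := volume.restrict (Ioo 0 t))
  have hK : ∀ᵐ s ∂volume.restrict (Ioo 0 t), ‖deriv v s‖ ≤ K := by
    filter_upwards [ae_restrict_mem measurableSet_Ioo] with s hs
    exact abs_deriv_le_of_lipschitzOn hv hs
  exact caputo_add_eq_halfConv hα ht hv.continuousOn
    (fun ε hε => ⟨K, hv.mono (Icc_subset_Icc_left hε.1.le)⟩)
    (Measure.integrableOn_of_bounded measure_Ioo_lt_top.ne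
      (measurable_deriv v).aestronglyMeasurable hK)
    (integral_deriv_of_lipschitzOn ht.le hv0 hv)
    ((integrableOn_comp_sub_left (integrableOn_fracKernel (sub_pos.2 hα.2) t)).mul_bdd hmeas hK)

theorem halfConv_resolventKernel_caputo_add (hα : α ∈ Ioo (0 : ℝ) 1) (ht : 0 < t) (hv0 : v 0 = 0)
    (hv : LipschitzOnWith K v (Icc 0 t)) :
    IntegrableOn (fun s => resolventKernel α lam (t - s) * (caputo α v s + lam * v s)) (Ioo 0 t) ∧
      halfConv (resolventKernel α lam) (fun s => caputo α v s + lam * v s) t = v t := by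
  have hconv : EqOn (fun s => caputo α v s + lam * v s)
      (halfConv (barrierR₀ α lam) (deriv v)) (Ioo 0 t) := fun s hs =>
    caputo_add_eq_halfConv_of_lipschitzOn hα hs.1 hv0 (hv.mono (Icc_subset_Icc_right hs.2.le))
  have hR := integrableOn_resolventKernel hα.1 lam t
  have hB := integrableOn_barrierR₀ hα.2 lam t
  have hK := fun s hs => abs_deriv_le_of_lipschitzOn (s := s) hv hs
  have hmeas := (measurable_deriv v).aestronglyMeasurable (μ := volume)
  refine ⟨(integrableOn_mul_halfConv hR hB hmeas hK).congr_fun (fun s hs => ?_)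
    measurableSet_Ioo, ?_⟩
  · simp only [← hconv hs]
  · calc halfConv (resolventKernel α lam) (fun s => caputo α v s + lam * v s) t
        = halfConv (resolventKernel α lam) (halfConv (barrierR₀ α lam) (deriv v)) t :=
          halfConv_congr (fun _ _ => rfl) hconv
      _ = halfConv (halfConv (resolventKernel α lam) (barrierR₀ α lam)) (deriv v) t :=
          halfConv_assoc hR hB hmeas hK
      _ = halfConv (fun _ => 1) (deriv v) t :=
          halfConv_congr (fun q hq => (halfConv_comm _ _ q).trans
            (halfConv_barrierR₀_resolventKernel hα lam hq.1)) fun _ _ => rfl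
      _ = v t := by
          simp only [halfConv, one_mul]
          exact integral_deriv_of_lipschitzOn ht.le hv0 hv

end Representation

section Positivity

variable {α lam t x T : ℝ}

/-- The solution `v` of `(D_t^α + λ) v = 1`, `v(0) = 0`. -/
def stepResponse (α lam t : ℝ) : ℝ := ∫ s in (0)..t, resolventKernel α lam s

theorem stepResponse_zero (α lam : ℝ) : stepResponse α lam 0 = 0 :=
  intervalIntegral.integral_same

theorem intervalIntegrable_resolventKernel (hα : 0 < α) (lam : ℝ) (ht : 0 ≤ t) :
    IntervalIntegrable (resolventKernel α lam) volume 0 t :=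
  (intervalIntegrable_iff_integrableOn_Ioo_of_le ht).2 (integrableOn_resolventKernel hα lam t)

theorem hasDerivAt_stepResponse (hα : 0 < α) (lam : ℝ) (ht : 0 < t) :
    HasDerivAt (stepResponse α lam) (resolventKernel α lam t) t :=
  intervalIntegral.integral_hasDerivAt_right (intervalIntegrable_resolventKernel hα lam ht.le)
    ((continuousOn_resolventKernel hα lam).stronglyMeasurableAtFilter isOpen_Ioi t ht)
    ((continuousOn_resolventKernel hα lam).continuousAt (Ioi_mem_nhds ht))

theorem continuousOn_stepResponse (hα : 0 < α) (lam T : ℝ) :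
    ContinuousOn (stepResponse α lam) (Icc 0 T) := by
  rcases le_or_gt 0 T with hT | hT
  · have h := intervalIntegral.continuousOn_primitive_interval' (a := 0)
      (intervalIntegrable_resolventKernel hα lam hT) left_mem_uIcc
    rwa [uIcc_of_le hT] at h
  · simp [Icc_eq_empty (not_le.2 hT)]

theorem exists_lipschitzOnWith_stepResponse (hα : 0 < α) (lam T : ℝ) {ε : ℝ} (hε : 0 < ε) :
    ∃ K : ℝ≥0, LipschitzOnWith K (stepResponse α lam) (Icc ε T) := by
  have hpos : ∀ s ∈ Icc ε T, 0 < s := fun s hs => hε.trans_le hs.1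
  obtain ⟨C, hC⟩ := isCompact_Icc.exists_bound_of_continuousOn
    ((continuousOn_resolventKernel hα lam).mono hpos)
  refine ⟨C.toNNReal, (convex_Icc ε T).lipschitzOnWith_of_nnnorm_hasDerivWithin_le
    (fun s hs => (hasDerivAt_stepResponse hα lam (hpos s hs)).hasDerivWithinAt) fun s hs => ?_⟩
  exact NNReal.coe_le_coe.1 ((hC s hs).trans (Real.le_coe_toNNReal C))

theorem hasCaputo_stepResponse (hα : α ∈ Ioo (0 : ℝ) 1) (lam : ℝ) (ht : 0 < t) :
    HasCaputo α (stepResponse α lam) t := by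
  obtain ⟨K, hK⟩ := exists_lipschitzOnWith_stepResponse hα.1 lam t (half_pos ht)
  exact hasCaputo_of_lipschitzOn hα.2 (continuousOn_stepResponse hα.1 lam t) (half_lt_self ht) hK

theorem caputo_stepResponse_add (hα : α ∈ Ioo (0 : ℝ) 1) (lam : ℝ) (ht : 0 < t) :
    caputo α (stepResponse α lam) t + lam * stepResponse α lam t = 1 := by
  have hderiv : EqOn (resolventKernel α lam) (deriv (stepResponse α lam)) (Ioo 0 t) :=
    fun s hs => (hasDerivAt_stepResponse hα.1 lam hs.1).deriv.symm
  rw [caputo_add_eq_halfConv hα ht (continuousOn_stepResponse hα.1 lam t)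
    (fun ε hε => exists_lipschitzOnWith_stepResponse hα.1 lam t hε.1)
    ((integrableOn_resolventKernel hα.1 lam t).congr_fun hderiv measurableSet_Ioo),
    ← halfConv_congr (fun _ _ => rfl) hderiv, halfConv_barrierR₀_resolventKernel hα lam ht]
  · rw [← setIntegral_congr_fun measurableSet_Ioo hderiv, ← integral_Ioc_eq_integral_Ioo,
      ← intervalIntegral.integral_of_le ht.le, stepResponse]
  · refine (integrableOn_fracKernel_mul_resolventKernel hα.1 (sub_pos.2 hα.2) lam ht).congr_fun
      (fun s hs => ?_) measurableSet_Ioo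
    simp only [hderiv hs]

theorem caputo_delay_stepResponse_add_le (hα : α ∈ Ioo (0 : ℝ) 1) (lam : ℝ) {δ : ℝ} (hδ : 0 ≤ δ) :
    HasCaputo α (delay δ (stepResponse α lam)) t ∧
      caputo α (delay δ (stepResponse α lam)) t + lam * delay δ (stepResponse α lam) t ≤ 1 := by
  rcases le_or_gt t δ with h | h
  · refine ⟨hasCaputo_delay_of_le h, ?_⟩
    simp [caputo_delay_of_le hδ h, delay_of_le h, stepResponse_zero]
  · have hv := hasCaputo_stepResponse hα lam (sub_pos.2 h)
    refine ⟨hasCaputo_delay hδ h hv, ?_⟩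
    rw [caputo_delay hα.1.ne' hδ h hv, delay_of_ge h.le,
      caputo_stepResponse_add hα lam (sub_pos.2 h)]

/- The delayed step response is driven by a smaller right-hand side, the indicator of `(δ, ∞)`,
so the comparison principle applies to the difference. -/
theorem delay_stepResponse_le (hα : α ∈ Ioo (0 : ℝ) 1) (hlam : 0 ≤ lam) {δ : ℝ} (hδ : 0 ≤ δ)
    (ht : 0 < t) : delay δ (stepResponse α lam) t ≤ stepResponse α lam t := by
  have hv := continuousOn_stepResponse hα.1 lam t
  have hcont : ContinuousOn (fun s => stepResponse α lam s - delay δ (stepResponse α lam) s)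
      (Icc 0 t) :=
    hv.sub (hv.comp (f := fun s => max (s - δ) 0) (by fun_prop) fun s hs =>
      ⟨le_max_right _ _, max_le (by linarith [hs.2]) ht.le⟩)
  have hzero : stepResponse α lam 0 - delay δ (stepResponse α lam) 0 = 0 := by
    rw [delay_of_le hδ, sub_self]
  refine sub_nonneg.1 (nonneg_of_caputo_add_nonneg hα hlam (hcont.mono Ioc_subset_Icc_self)
    hzero.ge (fun ε hε => ?_) (fun s hs => ?_) t ⟨ht, le_rfl⟩)
  · exact (tendsto_nhdsGT_zero_of_continuousOn ht hcont).eventually_const_lt (by linarith)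
  · obtain ⟨hdelay, hle⟩ := caputo_delay_stepResponse_add_le hα lam hδ
    rw [caputo_sub (hasCaputo_stepResponse hα lam hs.1) hdelay]
    linarith [caputo_stepResponse_add hα lam hs.1]

theorem resolventKernel_nonneg (hα : α ∈ Ioo (0 : ℝ) 1) (hlam : 0 ≤ lam) (hx : 0 < x) :
    0 ≤ resolventKernel α lam x := by
  have hmono : MonotoneOn (stepResponse α lam) (Ioi 0) := fun s hs t ht hst => by
    have h := delay_stepResponse_le hα hlam (sub_nonneg.2 hst) ht
    rwa [delay_of_ge (by linarith [mem_Ioi.1 hs]), sub_sub_cancel] at h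
  rw [← (hasDerivAt_stepResponse hα.1 lam hx).deriv,
    ← derivWithin_of_isOpen isOpen_Ioi (mem_Ioi.2 hx)]
  exact hmono.derivWithin_nonneg

end Positivity

section Subsolution

variable {α lam T t δ : ℝ} {m B r : ℝ → ℝ} {g : ℝ → ℝ≥0∞}

/-- `m` is a subsolution on `[0, T]` of the scalar problem `(D_t^α + λ) v = g`, `v 0 = 0`, with the
regularity in time that the error inherits from the class `Regular`. As `g` takes values in
`[0, ∞]`, the inequality `(D_t^α + λ) m ≤ g` is stated for the positive part of the left side. -/
structure IsSubsolution (α lam T : ℝ) (g : ℝ → ℝ≥0∞) (m : ℝ → ℝ) : Prop where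
  continuousOn : ContinuousOn m (Icc 0 T)
  map_zero : m 0 = 0
  lipschitz : ∀ ε > 0, ∃ K : ℝ≥0, LipschitzOnWith K m (Icc ε T)
  caputo_add_le : ∀ t ∈ Ioc 0 T, ENNReal.ofReal (caputo α m t + lam * m t) ≤ g t

theorem ofReal_integral_le_lintegral {β : Type*} [MeasurableSpace β]
    {μ : Measure β} {f : β → ℝ} (hf : Integrable f μ) :
    ENNReal.ofReal (∫ x, f x ∂μ) ≤ ∫⁻ x, ENNReal.ofReal (f x) ∂μ := by
  rw [integral_eq_lintegral_pos_part_sub_lintegral_neg_part hf]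
  exact (ENNReal.ofReal_le_ofReal (sub_le_self _ ENNReal.toReal_nonneg)).trans
    ENNReal.ofReal_toReal_le

namespace IsSubsolution

theorem mono_time (hm : IsSubsolution α lam T g m) (ht : t ≤ T) : IsSubsolution α lam t g m where
  continuousOn := hm.continuousOn.mono (Icc_subset_Icc_right ht)
  map_zero := hm.map_zero
  lipschitz ε hε := (hm.lipschitz ε hε).imp fun _ hK => hK.mono (Icc_subset_Icc_right ht)
  caputo_add_le s hs := hm.caputo_add_le s ⟨hs.1, hs.2.trans ht⟩

theorem hasCaputo (hα : α < 1) (hm : IsSubsolution α lam T g m) (ht : t ∈ Ioc 0 T) :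
    HasCaputo α m t := by
  obtain ⟨K, hK⟩ := (hm.mono_time ht.2).lipschitz (t / 2) (half_pos ht.1)
  exact hasCaputo_of_lipschitzOn hα (hm.mono_time ht.2).continuousOn (half_lt_self ht.1) hK

theorem le_of_le_caputo_add {E : ℝ → ℝ} (hα : α ∈ Ioo (0 : ℝ) 1) (hlam : 0 ≤ lam)
    (hm : IsSubsolution α lam T g m) (hE : ContinuousOn E (Ioc 0 T)) (hE0 : ∀ t ∈ Icc 0 T, 0 ≤ E t)
    (hEC : ∀ t ∈ Ioc 0 T, HasCaputo α E t)
    (h : ∀ t ∈ Ioc 0 T, (g t : EReal) ≤ ((caputo α E t + lam * E t : ℝ) : EReal)) :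
    ∀ t ∈ Icc 0 T, m t ≤ E t := by
  intro t ht
  rcases ht.1.eq_or_lt with rfl | ht0
  · simpa only [hm.map_zero] using hE0 0 ht
  have hT : 0 < T := ht0.trans_le ht.2
  refine sub_nonneg.1 (nonneg_of_caputo_add_nonneg (z := fun s => E s - m s) hα hlam
    (hE.sub (hm.continuousOn.mono Ioc_subset_Icc_self)) ?_ (fun ε hε => ?_) (fun s hs => ?_)
    t ⟨ht0, ht.2⟩)
  · simpa only [hm.map_zero, sub_zero] using hE0 0 ⟨le_rfl, hT.le⟩
  · have hlim := tendsto_nhdsGT_zero_of_continuousOn hT hm.continuousOn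
    rw [hm.map_zero] at hlim
    filter_upwards [hlim.eventually_lt_const hε, Icc_mem_nhdsGT hT] with s hs hsT
    linarith [hE0 s hsT]
  · have hle := (EReal.coe_ennreal_le_coe_ennreal_iff.2 (hm.caputo_add_le s hs)).trans (h s hs)
    rw [EReal.coe_ennreal_ofReal, EReal.coe_le_coe_iff] at hle
    rw [caputo_sub (hEC s hs) (hm.hasCaputo hα.2 hs)]
    linarith [(le_max_left _ _).trans hle]

theorem exists_lipschitzOnWith_max_sub (hT : 0 < T) (hm : IsSubsolution α lam T g m) (hδ : 0 < δ) :
    ∃ K : ℝ≥0, LipschitzOnWith K (fun s => max (m s - δ) 0) (Icc 0 T) := by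
  set v : ℝ → ℝ := fun s => max (m s - δ) 0
  have hlim := tendsto_nhdsGT_zero_of_continuousOn hT hm.continuousOn
  rw [hm.map_zero] at hlim
  obtain ⟨u, hu, hum⟩ := mem_nhdsGT_iff_exists_Ioc_subset.1 (hlim.eventually_le_const hδ)
  have hη : 0 < min u T := lt_min hu hT
  set η := min u T
  have hv0 : ∀ s ∈ Icc 0 η, v s = 0 := fun s hs => by
    refine max_eq_right (sub_nonpos.2 ?_)
    rcases hs.1.eq_or_lt with rfl | hs0
    · exact hm.map_zero.trans_le hδ.le
    · exact hum ⟨hs0, hs.2.trans (min_le_left _ _)⟩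
  have hcut : EqOn (v ∘ fun s => max η s) v (Icc 0 T) := fun s hs => by
    rcases le_total η s with h | h
    · simp only [Function.comp_apply, max_eq_right h]
    · rw [Function.comp_apply, max_eq_left h, hv0 s ⟨hs.1, h⟩, hv0 η ⟨hη.le, le_rfl⟩]
  obtain ⟨K, hK⟩ := hm.lipschitz η hη
  have hvK : LipschitzOnWith K v (Icc η T) := LipschitzOnWith.of_dist_le_mul fun x hx y hy => by
    refine (abs_max_sub_max_le_abs _ _ _).trans ?_
    rw [sub_sub_sub_cancel_right]
    exact hK.dist_le_mul x hx y hy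
  have hvcut : LipschitzOnWith (K * 1) (v ∘ fun s => max η s) (Icc 0 T) :=
    hvK.comp (LipschitzWith.id.const_max η).lipschitzOnWith
      fun s hs => ⟨le_max_left _ _, max_le (min_le_right _ _) hs.2⟩
  exact ⟨K * 1, fun x hx y hy => by simpa only [hcut hx, hcut hy] using hvcut hx hy⟩

theorem max_sub (hα : α ∈ Ioo (0 : ℝ) 1) (hlam : 0 ≤ lam) (hT : 0 < T)
    (hm : IsSubsolution α lam T g m) (hδ : 0 < δ) :
    IsSubsolution α lam T g fun s => max (m s - δ) 0 := by
  obtain ⟨K, hK⟩ := hm.exists_lipschitzOnWith_max_sub hT hδ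
  refine ⟨hK.continuousOn, by simp [hm.map_zero, hδ.le],
    fun ε hε => ⟨K, hK.mono (Icc_subset_Icc_left hε.le)⟩, fun t ht => ?_⟩
  rcases le_or_gt (m t) δ with hle | hgt
  · have hzero : max (m t - δ) 0 = 0 := max_eq_right (sub_nonpos.2 hle)
    have hcaputo : caputo α (fun s => max (m s - δ) 0) t ≤ 0 :=
      caputo_nonpos_of_forall_le hα ht.1 fun s _ => hzero.trans_le (le_max_right _ _)
    rw [hzero, mul_zero, add_zero, ENNReal.ofReal_of_nonpos hcaputo]
    exact zero_le
  · have hpos : max (m t - δ) 0 = m t - δ := max_eq_left (sub_pos.2 hgt).le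
    have hcaputo : caputo α (fun s => max (m s - δ) 0) t ≤ caputo α m t :=
      caputo_le_caputo hα ht.1 (hasCaputo_of_lipschitzOn hα.2
        (hK.continuousOn.mono (Icc_subset_Icc_right ht.2)) ht.1
        (hK.mono (Icc_subset_Icc_right ht.2))) (hm.hasCaputo hα.2 ht) fun s _ => by
          rw [hpos]
          linarith [le_max_left (m s - δ) 0]
    refine (ENNReal.ofReal_le_ofReal (add_le_add hcaputo ?_)).trans (hm.caputo_add_le t ht)
    rw [hpos]
    exact mul_le_mul_of_nonneg_left (by linarith) hlam

theorem ofReal_le_invCaputoAdd_of_lipschitz {K : ℝ≥0} (hα : α ∈ Ioo (0 : ℝ) 1) (hlam : 0 ≤ lam)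
    (hm : IsSubsolution α lam T g m) (hK : LipschitzOnWith K m (Icc 0 T)) (ht : t ∈ Ioc 0 T) :
    ENNReal.ofReal (m t) ≤ invCaputoAdd α lam g t := by
  obtain ⟨hint, hrep⟩ := halfConv_resolventKernel_caputo_add (lam := lam) hα ht.1 hm.map_zero
    (hK.mono (Icc_subset_Icc_right ht.2))
  rw [← hrep]
  refine (ofReal_integral_le_lintegral hint).trans
    (setLIntegral_mono' measurableSet_Ioo fun s hs => ?_)
  rw [ENNReal.ofReal_mul (resolventKernel_nonneg hα hlam (sub_pos.2 hs.2))]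
  exact mul_le_mul_right (hm.caputo_add_le s ⟨hs.1, hs.2.le.trans ht.2⟩) _

/- Truncating at height `δ` makes `m` Lipschitz up to time `0`, where the representation by the
resolvent kernel holds. -/
theorem ofReal_le_invCaputoAdd (hα : α ∈ Ioo (0 : ℝ) 1) (hlam : 0 ≤ lam)
    (hm : IsSubsolution α lam T g m) (ht : t ∈ Ioc 0 T) :
    ENNReal.ofReal (m t) ≤ invCaputoAdd α lam g t := by
  have hT : 0 < T := ht.1.trans_le ht.2
  have htrunc : ∀ δ > 0, ENNReal.ofReal (m t - δ) ≤ invCaputoAdd α lam g t := fun δ hδ => by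
    obtain ⟨K, hK⟩ := hm.exists_lipschitzOnWith_max_sub hT hδ
    exact (ENNReal.ofReal_le_ofReal (le_max_left _ 0)).trans
      ((hm.max_sub hα hlam hT hδ).ofReal_le_invCaputoAdd_of_lipschitz hα hlam hK ht)
  have hlim : Tendsto (fun δ => ENNReal.ofReal (m t - δ)) (𝓝[>] 0)
      (𝓝 (ENNReal.ofReal (m t - 0))) :=
    (ENNReal.continuous_ofReal.comp (continuous_sub_left (m t))).continuousWithinAt
  rw [sub_zero] at hlim
  exact le_of_tendsto hlim (eventually_mem_nhdsWithin.mono htrunc)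

theorem ofReal_le_mul_iSup_div (hα : α ∈ Ioo (0 : ℝ) 1) (hlam : 0 ≤ lam)
    (hm : IsSubsolution α lam T g m) (hB : ContinuousOn B (Ioc 0 T)) (hB0 : 0 ≤ B 0)
    (hBpos : ∀ t ∈ Ioc 0 T, 0 < B t) (hBC : ∀ t ∈ Ioc 0 T, HasCaputo α B t)
    (hr : ∀ t ∈ Ioc 0 T, 0 < r t) (hBr : ∀ t ∈ Ioc 0 T, r t ≤ caputo α B t + lam * B t)
    (ht : t ∈ Ioc 0 T) :
    ENNReal.ofReal (m t) ≤
      ENNReal.ofReal (B t) * ⨆ s ∈ Ioc 0 t, g s / ENNReal.ofReal (r s) := by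
  set S := ⨆ s ∈ Ioc 0 t, g s / ENNReal.ofReal (r s)
  rcases eq_or_ne S ⊤ with htop | htop
  · rw [htop, ENNReal.mul_top (ENNReal.ofReal_pos.2 (hBpos t ht)).ne']
    exact le_top
  have hmem : ∀ s ∈ Ioc 0 t, s ∈ Ioc 0 T := fun s hs => ⟨hs.1, hs.2.trans ht.2⟩
  have hM : 0 ≤ S.toReal := ENNReal.toReal_nonneg
  have hg : ∀ s ∈ Ioc 0 t, (g s : EReal) ≤
      ((caputo α (fun q => S.toReal * B q) s + lam * (S.toReal * B s) : ℝ) : EReal) := by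
    intro s hs
    have hle : g s ≤ ENNReal.ofReal (S.toReal * r s) := by
      rw [ENNReal.ofReal_mul hM, ENNReal.ofReal_toReal htop, ← ENNReal.div_le_iff
        (ENNReal.ofReal_pos.2 (hr s (hmem s hs))).ne' ENNReal.ofReal_ne_top]
      exact le_iSup₂ (f := fun s (_ : s ∈ Ioc 0 t) => g s / ENNReal.ofReal (r s)) s hs
    refine (EReal.coe_ennreal_le_coe_ennreal_iff.2 hle).trans ?_
    rw [EReal.coe_ennreal_ofReal, EReal.coe_le_coe_iff,
      max_eq_left (mul_nonneg hM (hr s (hmem s hs)).le), caputo_const_mul, mul_left_comm lam,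
      ← mul_add]
    exact mul_le_mul_of_nonneg_left (hBr s (hmem s hs)) hM
  have hmB : m t ≤ S.toReal * B t :=
    (hm.mono_time ht.2).le_of_le_caputo_add (E := fun s => S.toReal * B s) hα hlam
      (continuousOn_const.mul (hB.mono hmem))
      (fun s hs => mul_nonneg hM <| hs.1.eq_or_lt.elim (fun h => h ▸ hB0)
        fun h => (hBpos s (hmem s ⟨h, hs.2⟩)).le)
      (fun s hs => (hBC s (hmem s hs)).const_mul _) hg t ⟨ht.1.le, le_rfl⟩
  calc ENNReal.ofReal (m t) ≤ ENNReal.ofReal (S.toReal * B t) := ENNReal.ofReal_le_ofReal hmB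
    _ = ENNReal.ofReal (B t) * S := by
      rw [ENNReal.ofReal_mul hM, ENNReal.ofReal_toReal htop, mul_comm]

end IsSubsolution

end Subsolution

section Barrier

variable {α lam s t τ : ℝ} {W : ℝ → ℝ}

theorem caputoIntegrand_indicator_Ioi (α : ℝ) (W : ℝ → ℝ) (ht : 0 < t) :
    EqOn (caputoIntegrand α ((Ioi 0).indicator W) t) (caputoIntegrand α W t) (Ioo 0 t) :=
  fun s hs => by
    simp only [caputoIntegrand, indicator_of_mem (mem_Ioi.2 ht), indicator_of_mem (mem_Ioi.2 hs.1)]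

theorem HasCaputo.indicator_Ioi (ht : 0 < t) (hW : HasCaputo α W t) :
    HasCaputo α ((Ioi 0).indicator W) t :=
  IntegrableOn.congr_fun hW (caputoIntegrand_indicator_Ioi α W ht).symm measurableSet_Ioo

theorem caputo_indicator_Ioi (α : ℝ) (W : ℝ → ℝ) (ht : 0 < t) :
    caputo α ((Ioi 0).indicator W) t =
      caputo α W t + (Real.Gamma (1 - α))⁻¹ * t ^ (-α) * W 0 := by
  simp only [caputo, indicator_of_mem (mem_Ioi.2 ht), indicator_of_notMem self_notMem_Ioi,
    setIntegral_congr_fun measurableSet_Ioo (caputoIntegrand_indicator_Ioi α W ht)]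
  ring

theorem le_rho (hα : α ∈ Ioo (0 : ℝ) 1) (hs : 0 < s) :
    s ^ (-(1 - α)) * min ((1 - α) * s) 1 ≤ rho α s := by
  refine mul_le_mul_of_nonneg_left ?_ (Real.rpow_nonneg hs.le _)
  rcases le_or_gt 1 s with h | h
  · rw [max_eq_left (by linarith), Real.zero_rpow (by linarith [hα.2]), sub_zero]
    exact min_le_right _ _
  · have bernoulli := rpow_one_add_le_one_add_mul_self (s := -s) (p := 1 - α) (by linarith)
      (by linarith [hα.2]) (by linarith [hα.1])
    rw [max_eq_right (by linarith)]
    rw [← sub_eq_add_neg] at bernoulli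
    exact (min_le_left _ _).trans (by linarith)

theorem rho_pos (hα : α ∈ Ioo (0 : ℝ) 1) (hs : 0 < s) : 0 < rho α s :=
  (mul_pos (Real.rpow_pos_of_pos hs _)
    (lt_min (mul_pos (sub_pos.2 hα.2) hs) one_pos)).trans_le (le_rho hα hs)

theorem barrierR₀_pos (hα : α < 1) (hlam : 0 ≤ lam) (ht : 0 < t) : 0 < barrierR₀ α lam t :=
  add_pos_of_pos_of_nonneg (mul_pos (inv_Gamma_one_sub_pos hα) (Real.rpow_pos_of_pos ht _)) hlam

theorem barrierE₁_pos (hτ : 0 < τ) : 0 < barrierE₁ α τ t :=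
  Real.rpow_pos_of_pos (lt_max_of_lt_left hτ) _

theorem barrierR₁_pos (hα : α ∈ Ioo (0 : ℝ) 1) (hlam : 0 ≤ lam) (hτ : 0 < τ) (ht : 0 < t) :
    0 < barrierR₁ α lam τ t :=
  add_pos_of_pos_of_nonneg
    (mul_pos (mul_pos (inv_Gamma_one_sub_pos hα.2) (inv_pos.2 ht)) (rho_pos hα (div_pos hτ ht)))
    (mul_nonneg hlam (barrierE₁_pos hτ).le)

theorem exists_lipschitzWith_barrierE₁ (hα : α < 1) (hτ : 0 < τ) :
    ∃ K : ℝ≥0, LipschitzWith K (barrierE₁ α τ) := by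
  have hderiv : ∀ x ∈ Ici τ, HasDerivAt (fun x : ℝ => x ^ (α - 1)) ((α - 1) * x ^ (α - 2)) x :=
    fun x hx => by
      have h := Real.hasDerivAt_rpow_const (p := α - 1) (Or.inl (hτ.trans_le hx).ne')
      rwa [show α - 1 - 1 = α - 2 by ring] at h
  have hbound : ∀ x ∈ Ici τ, |(α - 1) * x ^ (α - 2)| ≤ (1 - α) * τ ^ (α - 2) := fun x hx => by
    rw [abs_mul, abs_of_neg (by linarith), neg_sub,
      abs_of_pos (Real.rpow_pos_of_pos (hτ.trans_le hx) _)]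
    exact mul_le_mul_of_nonneg_left (Real.rpow_le_rpow_of_nonpos hτ hx (by linarith))
      (sub_pos.2 hα).le
  have hpow : LipschitzOnWith ((1 - α) * τ ^ (α - 2)).toNNReal (fun x : ℝ => x ^ (α - 1))
      (Ici τ) :=
    (convex_Ici τ).lipschitzOnWith_of_nnnorm_hasDerivWithin_le
      (fun x hx => (hderiv x hx).hasDerivWithinAt) fun x hx =>
        NNReal.coe_le_coe.1 ((hbound x hx).trans (Real.le_coe_toNNReal _))
  exact ⟨_, lipschitzOnWith_univ.1 (hpow.comp (f := fun x => max τ x)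
    (LipschitzWith.id.const_max τ).lipschitzOnWith fun x _ => le_max_left τ x)⟩

theorem deriv_barrierE₁_of_lt (α : ℝ) (hs : s < τ) : deriv (barrierE₁ α τ) s = 0 := by
  have hconst : barrierE₁ α τ =ᶠ[𝓝 s] fun _ => τ ^ (α - 1) := by
    filter_upwards [Iio_mem_nhds hs] with q hq
    rw [barrierE₁, max_eq_left (le_of_lt hq)]
  rw [hconst.deriv_eq, deriv_const]

theorem deriv_barrierE₁_of_gt (hs₀ : s ≠ 0) (hs : τ < s) :
    deriv (barrierE₁ α τ) s = (α - 1) * s ^ (α - 1 - 1) := by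
  have hpow : barrierE₁ α τ =ᶠ[𝓝 s] fun q => q ^ (α - 1) := by
    filter_upwards [Ioi_mem_nhds hs] with q hq
    rw [barrierE₁, max_eq_right (le_of_lt hq)]
  rw [hpow.deriv_eq, (Real.hasDerivAt_rpow_const (Or.inl hs₀)).deriv]

theorem hasDerivAt_inv_mul_sub_div_rpow (α : ℝ) (hs : 0 < s) (hst : s < t) :
    HasDerivAt (fun s => t⁻¹ * ((t - s) / s) ^ (1 - α))
      ((t - s) ^ (-α) * ((α - 1) * s ^ (α - 1 - 1))) s := by
  have hts : 0 < t - s := sub_pos.2 hst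
  have ht : t ≠ 0 := (hs.trans hst).ne'
  refine (((((hasDerivAt_id s).const_sub t).div (hasDerivAt_id s) hs.ne').rpow_const
    (p := 1 - α) (Or.inl (div_pos hts hs).ne')).const_mul t⁻¹).congr_deriv ?_
  simp only [id, Pi.div_apply]
  rw [show 1 - α - 1 = -α by ring, Real.div_rpow hts.le hs.le, Real.rpow_neg hs.le,
    show α - 1 - 1 = α - (2 : ℕ) by push_cast; ring, Real.rpow_sub_natCast hs.ne']
  field_simp
  ring

theorem integral_sub_rpow_mul_deriv_barrierE₁ (hα : α < 1) (hτ : 0 < τ)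
    (hint : IntegrableOn (fun s => (t - s) ^ (-α) * deriv (barrierE₁ α τ) s) (Ioo 0 t)) :
    ∫ s in Ioo 0 t, (t - s) ^ (-α) * deriv (barrierE₁ α τ) s =
      -(t⁻¹ * (max 0 (t - τ) / τ) ^ (1 - α)) := by
  have hα' : 1 - α ≠ 0 := (sub_pos.2 hα).ne'
  rcases le_or_gt t τ with htτ | htτ
  · rw [max_eq_left (by linarith), zero_div, Real.zero_rpow hα', mul_zero, neg_zero]
    exact setIntegral_eq_zero_of_forall_eq_zero fun s hs => by
      rw [deriv_barrierE₁_of_lt α (hs.2.trans_le htτ), mul_zero]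
  set G : ℝ → ℝ := fun s => t⁻¹ * ((t - s) / s) ^ (1 - α) with hG
  have hderiv : ∀ s ∈ Ioo τ t,
      HasDerivAt G ((t - s) ^ (-α) * deriv (barrierE₁ α τ) s) s := fun s hs => by
    rw [deriv_barrierE₁_of_gt (hτ.trans hs.1).ne' hs.1]
    exact hasDerivAt_inv_mul_sub_div_rpow α (hτ.trans hs.1) hs.2
  have hcont : ContinuousOn G (Icc τ t) :=
    continuousOn_const.mul ((ContinuousOn.div (by fun_prop) continuousOn_id
      fun s hs => (hτ.trans_le hs.1).ne').rpow_const fun _ _ => Or.inr (sub_pos.2 hα).le)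
  have hFTC : ∫ s in τ..t, (t - s) ^ (-α) * deriv (barrierE₁ α τ) s = G t - G τ :=
    intervalIntegral.integral_eq_sub_of_hasDerivAt_of_le htτ.le hcont hderiv
      ((intervalIntegrable_iff_integrableOn_Ioo_of_le htτ.le).2
        (hint.mono_set (Ioo_subset_Ioo_left hτ.le)))
  calc ∫ s in Ioo 0 t, (t - s) ^ (-α) * deriv (barrierE₁ α τ) s
      = ∫ s in Ico τ t, (t - s) ^ (-α) * deriv (barrierE₁ α τ) s := by
        refine setIntegral_eq_of_subset_of_forall_sdiff_eq_zero measurableSet_Ioo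
          (fun s hs => ⟨hτ.trans_le hs.1, hs.2⟩) fun s hs => ?_
        rw [deriv_barrierE₁_of_lt α (by by_contra! h; exact hs.2 ⟨h, hs.1.2⟩), mul_zero]
    _ = G t - G τ := by
        rw [← hFTC, intervalIntegral.integral_of_le htτ.le, integral_Ioc_eq_integral_Ioo,
          integral_Ico_eq_integral_Ioo]
    _ = -(t⁻¹ * (max 0 (t - τ) / τ) ^ (1 - α)) := by
        simp only [hG, sub_self, zero_div, Real.zero_rpow hα', mul_zero, zero_sub,
          max_eq_right (sub_pos.2 htτ).le]

theorem inv_mul_rho_div (α : ℝ) (hτ : 0 < τ) (ht : 0 < t) :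
    t⁻¹ * rho α (τ / t) =
      t ^ (-α) * τ ^ (α - 1) - t⁻¹ * (max 0 (t - τ) / τ) ^ (1 - α) := by
  have hM : 0 ≤ max 0 (t - τ) := le_max_left _ _
  have hmax : max 0 (1 - τ / t) = max 0 (t - τ) / t := by
    rw [← max_div_div_right ht.le, zero_div, sub_div, div_self ht.ne']
  have hpow : t⁻¹ * (τ / t) ^ (-(1 - α)) = t ^ (-α) * τ ^ (α - 1) := by
    rw [Real.div_rpow hτ.le ht.le, ← Real.rpow_neg_one t, neg_sub, div_eq_mul_inv,
      ← Real.rpow_neg ht.le, mul_left_comm, ← Real.rpow_add ht, mul_comm]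
    congr 2
    ring
  have hquot : (τ / t) ^ (-(1 - α)) * (max 0 (t - τ) / t) ^ (1 - α) =
      (max 0 (t - τ) / τ) ^ (1 - α) := by
    rw [Real.rpow_neg (div_pos hτ ht).le, ← Real.inv_rpow (div_pos hτ ht).le,
      ← Real.mul_rpow (inv_nonneg.2 (div_pos hτ ht).le) (div_nonneg hM ht.le)]
    congr 1
    field_simp
  rw [rho, hmax, mul_one_sub, hquot, mul_sub, hpow]

theorem caputo_indicator_barrierE₁_add (hα : α ∈ Ioo (0 : ℝ) 1) (lam : ℝ) (hτ : 0 < τ)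
    (ht : 0 < t) :
    caputo α ((Ioi 0).indicator (barrierE₁ α τ)) t +
      lam * (Ioi 0).indicator (barrierE₁ α τ) t = barrierR₁ α lam τ t := by
  obtain ⟨K, hK⟩ := exists_lipschitzWith_barrierE₁ hα.2 hτ
  have hint : IntegrableOn (fun s => (t - s) ^ (-α) * deriv (barrierE₁ α τ) s) (Ioo 0 t) :=
    (integrableOn_sub_rpow_neg hα.2 t).mul_bdd (c := K)
      (measurable_deriv _).aestronglyMeasurable
      (Eventually.of_forall fun s => norm_deriv_le_of_lipschitz hK)
  have hE₁0 : barrierE₁ α τ 0 = τ ^ (α - 1) := by rw [barrierE₁, max_eq_left hτ.le]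
  rw [caputo_indicator_Ioi α _ ht, indicator_of_mem (mem_Ioi.2 ht), caputo_eq_integral_deriv hα ht
      (hK.continuous.tendsto 0 |>.mono_left nhdsWithin_le_nhds)
      (fun ε _ => ⟨K, hK.lipschitzOnWith⟩) hint,
    integral_sub_rpow_mul_deriv_barrierE₁ hα.2 hτ hint, hE₁0, barrierR₁, mul_assoc _ t⁻¹,
    inv_mul_rho_div α hτ ht]
  ring

theorem hasCaputo_indicator_barrierE₁ (hα : α < 1) (hτ : 0 < τ) (ht : 0 < t) :
    HasCaputo α ((Ioi 0).indicator (barrierE₁ α τ)) t := by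
  obtain ⟨K, hK⟩ := exists_lipschitzWith_barrierE₁ hα hτ
  exact (hasCaputo_of_lipschitzOn hα hK.continuous.continuousOn ht
    hK.lipschitzOnWith).indicator_Ioi ht

theorem caputo_indicator_one_add (α lam : ℝ) (ht : 0 < t) :
    caputo α ((Ioi 0).indicator 1) t + lam * (Ioi 0).indicator 1 t = barrierR₀ α lam t := by
  rw [caputo_indicator_Ioi α _ ht, indicator_of_mem (mem_Ioi.2 ht), barrierR₀]
  simp [caputo, caputoIntegrand]

theorem hasCaputo_indicator_one (hα : α < 1) (ht : 0 < t) :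
    HasCaputo α ((Ioi 0).indicator 1) t :=
  (hasCaputo_of_abs_sub_le (C := 0) hα continuousOn_const (by simp)).indicator_Ioi ht

end Barrier

namespace IsSubsolution

variable {α lam T t τ : ℝ} {m : ℝ → ℝ} {g : ℝ → ℝ≥0∞}

theorem ofReal_le_iSup_div_barrierR₀ (hα : α ∈ Ioo (0 : ℝ) 1) (hlam : 0 ≤ lam)
    (hm : IsSubsolution α lam T g m) (ht : t ∈ Ioc 0 T) :
    ENNReal.ofReal (m t) ≤ ⨆ s ∈ Ioc 0 t, g s / ENNReal.ofReal (barrierR₀ α lam s) := by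
  have hone : EqOn ((Ioi (0 : ℝ)).indicator 1) (1 : ℝ → ℝ) (Ioi 0) := eqOn_indicator
  have h := hm.ofReal_le_mul_iSup_div (B := (Ioi 0).indicator 1) hα hlam
    ((continuousOn_const.congr hone).mono Ioc_subset_Ioi_self)
    (indicator_of_notMem self_notMem_Ioi _).ge
    (fun s hs => (one_pos (α := ℝ)).trans_eq (hone hs.1).symm)
    (fun s hs => hasCaputo_indicator_one hα.2 hs.1) (fun s hs => barrierR₀_pos hα.2 hlam hs.1)
    (fun s hs => (caputo_indicator_one_add α lam hs.1).ge) ht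
  rwa [hone ht.1, Pi.one_apply, ENNReal.ofReal_one, one_mul] at h

theorem ofReal_le_barrierE₁_mul_iSup_div (hα : α ∈ Ioo (0 : ℝ) 1) (hlam : 0 ≤ lam)
    (hm : IsSubsolution α lam T g m) (hτ : 0 < τ) (ht : t ∈ Ioc 0 T) :
    ENNReal.ofReal (m t) ≤ ENNReal.ofReal (barrierE₁ α τ t) *
      ⨆ s ∈ Ioc 0 t, g s / ENNReal.ofReal (barrierR₁ α lam τ s) := by
  obtain ⟨K, hK⟩ := exists_lipschitzWith_barrierE₁ hα.2 hτ
  have hE₁ : EqOn ((Ioi 0).indicator (barrierE₁ α τ)) (barrierE₁ α τ) (Ioi 0) := eqOn_indicator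
  have h := hm.ofReal_le_mul_iSup_div (B := (Ioi 0).indicator (barrierE₁ α τ)) hα hlam
    ((hK.continuous.continuousOn.congr hE₁).mono Ioc_subset_Ioi_self)
    (indicator_of_notMem self_notMem_Ioi _).ge
    (fun s hs => (barrierE₁_pos hτ).trans_eq (hE₁ hs.1).symm)
    (fun s hs => hasCaputo_indicator_barrierE₁ hα.2 hτ hs.1)
    (fun s hs => barrierR₁_pos hα hlam hτ hs.1)
    (fun s hs => (caputo_indicator_barrierE₁_add hα lam hτ hs.1).ge) ht
  rwa [hE₁ ht.1] at h

end IsSubsolution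

section WeakDerivative

open scoped Convolution

variable {s t : ℝ}

/-- The mollification of the indicator function of `[s, t]` by a normalized bump function: a test
function that turns a weak derivative into a difference of values at `t` and `s`. -/
def smoothedIndicator (η : ContDiffBump (0 : ℝ)) (s t r : ℝ) : ℝ :=
  ∫ q in (r - t)..(r - s), η.normed volume q

theorem hasDerivAt_smoothedIndicator (η : ContDiffBump (0 : ℝ)) (s t r : ℝ) :
    HasDerivAt (smoothedIndicator η s t)
      (η.normed volume (r - s) - η.normed volume (r - t)) r := by
  have hcont : Continuous (η.normed (volume : Measure ℝ)) := η.continuous_normed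
  have hprim : ∀ x, HasDerivAt (fun x => ∫ q in (0)..x, η.normed volume q)
      (η.normed volume x) x := fun x => hcont.integral_hasStrictDerivAt 0 x |>.hasDerivAt
  refine ((hprim _).comp_sub_const r s |>.sub ((hprim _).comp_sub_const r t)).congr_of_eventuallyEq
    (Eventually.of_forall fun x => ?_)
  exact (intervalIntegral.integral_interval_sub_left (hcont.intervalIntegrable _ _)
    (hcont.intervalIntegrable _ _)).symm

theorem contDiff_smoothedIndicator (η : ContDiffBump (0 : ℝ)) (s t : ℝ) :
    ContDiff ℝ ∞ (smoothedIndicator η s t) := by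
  refine contDiff_infty_iff_deriv.2
    ⟨fun r => (hasDerivAt_smoothedIndicator η s t r).differentiableAt, ?_⟩
  rw [funext fun r => (hasDerivAt_smoothedIndicator η s t r).deriv]
  exact (η.contDiff_normed.comp (contDiff_id.sub contDiff_const)).sub
    (η.contDiff_normed.comp (contDiff_id.sub contDiff_const))

theorem smoothedIndicator_mem_Icc (η : ContDiffBump (0 : ℝ)) (hst : s ≤ t) (r : ℝ) :
    smoothedIndicator η s t r ∈ Icc 0 1 := by
  have hle : r - t ≤ r - s := sub_le_sub_left hst r
  refine ⟨intervalIntegral.integral_nonneg hle fun q _ => η.nonneg_normed q, ?_⟩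
  rw [smoothedIndicator, intervalIntegral.integral_of_le hle,
    ← η.integral_normed (μ := volume)]
  exact setIntegral_le_integral η.integrable_normed (Eventually.of_forall η.nonneg_normed)

theorem smoothedIndicator_eq_zero (η : ContDiffBump (0 : ℝ)) (hst : s ≤ t) {r : ℝ}
    (hr : r ∉ Icc (s - η.rOut) (t + η.rOut)) : smoothedIndicator η s t r = 0 := by
  refine intervalIntegral.integral_zero_ae (Eventually.of_forall fun q hq => ?_)
  rw [uIoc_of_le (sub_le_sub_left hst r)] at hq
  have hq' : q ∉ Function.support (η.normed (volume : Measure ℝ)) := by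
    rw [η.support_normed_eq, Metric.mem_ball, Real.dist_eq, sub_zero, not_lt, le_abs]
    rw [mem_Icc, not_and_or, not_le, not_le] at hr
    rcases hr with hr | hr
    · exact Or.inr (by linarith [hq.2])
    · exact Or.inl (by linarith [hq.1])
  exact Function.notMem_support.1 hq'

theorem tsupport_smoothedIndicator_subset (η : ContDiffBump (0 : ℝ)) (hst : s ≤ t) :
    tsupport (smoothedIndicator η s t) ⊆ Icc (s - η.rOut) (t + η.rOut) :=
  closure_minimal (fun _ hr => not_imp_comm.1 (smoothedIndicator_eq_zero η hst) hr) isClosed_Icc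

theorem integrableOn_normed_sub_mul (η : ContDiffBump (0 : ℝ)) {U : Set ℝ} {g : ℝ → ℝ}
    (hg : IntegrableOn g U) (x : ℝ) :
    IntegrableOn (fun r => η.normed volume (r - x) * g r) U := by
  have hcont : Continuous (η.normed (volume : Measure ℝ)) := η.continuous_normed
  obtain ⟨C, hC⟩ := hcont.bounded_above_of_compact_support η.hasCompactSupport_normed
  exact Integrable.bdd_mul (c := C) hg
    (hcont.comp (continuous_sub_right x)).aestronglyMeasurable
    (Eventually.of_forall fun r => hC _)

theorem tendsto_setIntegral_normed_sub_mul {ι : Type*} {l : Filter ι}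
    {η : ι → ContDiffBump (0 : ℝ)} (hη : Tendsto (fun i => (η i).rOut) l (𝓝 0)) {U : Set ℝ}
    (hU : IsOpen U) {g : ℝ → ℝ} (hg : ContinuousOn g U) {x : ℝ} (hx : x ∈ U) :
    Tendsto (fun i => ∫ r in U, (η i).normed volume (r - x) * g r) l (𝓝 (g x)) := by
  have hmeas : AEStronglyMeasurable (U.indicator g) volume :=
    (aestronglyMeasurable_indicator_iff hU.measurableSet).2
      (hg.aestronglyMeasurable hU.measurableSet)
  have hlim : Tendsto (U.indicator g) (𝓝 x) (𝓝 (g x)) :=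
    (hg.continuousAt (hU.mem_nhds hx)).tendsto.congr' <| by
      filter_upwards [hU.mem_nhds hx] with r hr using (indicator_of_mem hr g).symm
  refine (ContDiffBump.convolution_tendsto_right (μ := volume) (g := fun _ => U.indicator g)
    (k := fun _ => x) hη (Eventually.of_forall fun _ => hmeas) (hlim.comp tendsto_snd)
    tendsto_const_nhds).congr fun i => ?_
  rw [convolution_lsmul_swap, ← integral_indicator hU.measurableSet]
  refine integral_congr_ae (Eventually.of_forall fun r => ?_)
  have hsymm : (η i).normed volume (x - r) = (η i).normed volume (r - x) := by
    rw [← neg_sub r x, (η i).normed_neg]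
  by_cases hr : r ∈ U <;> simp [hr, hsymm]

theorem abs_setIntegral_smoothedIndicator_mul_le {K : ℝ} {U : Set ℝ} {h : ℝ → ℝ}
    (hU : MeasurableSet U) (hK : ∀ᵐ r ∂volume.restrict U, |h r| ≤ K) (η : ContDiffBump (0 : ℝ))
    (hst : s ≤ t) (hsub : Icc (s - η.rOut) (t + η.rOut) ⊆ U) :
    |∫ r in U, smoothedIndicator η s t r * h r| ≤ K * (t - s + 2 * η.rOut) := by
  rw [setIntegral_eq_of_subset_of_forall_sdiff_eq_zero hU hsub
    fun r hr => by rw [smoothedIndicator_eq_zero η hst hr.2, zero_mul]]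
  have hbound : ∀ᵐ r ∂volume.restrict (Icc (s - η.rOut) (t + η.rOut)),
      ‖smoothedIndicator η s t r * h r‖ ≤ K := by
    filter_upwards [ae_restrict_of_ae_restrict_of_subset hsub hK] with r hr
    obtain ⟨h0, h1⟩ := smoothedIndicator_mem_Icc η hst r
    rw [norm_mul, Real.norm_eq_abs, Real.norm_eq_abs, abs_of_nonneg h0]
    exact (mul_le_of_le_one_left (abs_nonneg _) h1).trans hr
  refine (norm_setIntegral_le_of_norm_le_const_ae measure_Icc_lt_top hbound).trans_eq ?_
  rw [Real.volume_real_Icc_of_le (by linarith [η.rOut_pos])]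
  ring

theorem abs_sub_le_of_weak_deriv {U : Set ℝ} {K : ℝ} {g h : ℝ → ℝ} (hU : IsOpen U)
    (hg : ContinuousOn g U) (hgi : IntegrableOn g U) (hK : ∀ᵐ r ∂volume.restrict U, |h r| ≤ K)
    (hw : ∀ φ : ℝ → ℝ, ContDiff ℝ ∞ φ → HasCompactSupport φ → tsupport φ ⊆ U →
      ∫ r in U, deriv φ r * g r = -∫ r in U, φ r * h r)
    (hst : s ≤ t) (hsub : Icc s t ⊆ U) : |g t - g s| ≤ K * (t - s) := by
  let η : ℕ → ContDiffBump (0 : ℝ) := fun n =>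
    ⟨1 / (n + 1) / 2, 1 / (n + 1), by positivity, half_lt_self (by positivity)⟩
  have hη : Tendsto (fun n => (η n).rOut) atTop (𝓝 0) := tendsto_one_div_add_atTop_nhds_zero_nat
  have hlim : Tendsto (fun n => |(∫ r in U, (η n).normed volume (r - t) * g r) -
      ∫ r in U, (η n).normed volume (r - s) * g r|) atTop (𝓝 |g t - g s|) :=
    ((tendsto_setIntegral_normed_sub_mul hη hU hg (hsub (right_mem_Icc.2 hst))).sub
      (tendsto_setIntegral_normed_sub_mul hη hU hg (hsub (left_mem_Icc.2 hst)))).abs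
  have hlimK : Tendsto (fun n => K * (t - s + 2 * (η n).rOut)) atTop (𝓝 (K * (t - s))) := by
    simpa using ((hη.const_mul 2).const_add (t - s)).const_mul K
  have hsmall : ∀ᶠ n in atTop, Icc (s - (η n).rOut) (t + (η n).rOut) ⊆ U := by
    obtain ⟨δ, hδ, hδU⟩ := isCompact_Icc.exists_thickening_subset_open hU hsub
    filter_upwards [hη.eventually_lt_const hδ] with n hn r hr
    refine hδU (Metric.mem_thickening_iff.2 ⟨max s (min t r), ⟨le_max_left _ _,
      max_le hst (min_le_left _ _)⟩, ?_⟩)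
    rw [Real.dist_eq, abs_lt]
    grind
  refine le_of_tendsto_of_tendsto hlim hlimK ?_
  filter_upwards [hsmall] with n hn
  have hts := (tsupport_smoothedIndicator_subset (η n) hst).trans hn
  have hcs : HasCompactSupport (smoothedIndicator (η n) s t) :=
    HasCompactSupport.of_support_subset_isCompact isCompact_Icc
      (subset_closure.trans (tsupport_smoothedIndicator_subset (η n) hst))
  have hmain := hw _ (contDiff_smoothedIndicator (η n) s t) hcs hts
  simp only [fun r => (hasDerivAt_smoothedIndicator (η n) s t r).deriv, sub_mul] at hmain
  rw [integral_sub (integrableOn_normed_sub_mul _ hgi s)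
    (integrableOn_normed_sub_mul _ hgi t)] at hmain
  rw [← neg_sub, hmain, neg_neg]
  exact abs_setIntegral_smoothedIndicator_mul_le hU.measurableSet hK (η n) hst hn

end WeakDerivative

section Norm

variable {d : ℕ} {Ω : Set (EuclideanSpace ℝ (Fin d))} {v : EuclideanSpace ℝ (Fin d) → ℝ} {C : ℝ}
  {x : EuclideanSpace ℝ (Fin d)}

theorem enorm_le_normLinf (hΩ : IsOpen Ω) (hv : ContinuousOn v Ω) (hx : x ∈ Ω) :
    ‖v x‖ₑ ≤ normLinf Ω v := by
  by_contra! hlt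
  have hopen : IsOpen (Ω ∩ (fun y => ‖v y‖ₑ) ⁻¹' Ioi (normLinf Ω v)) :=
    hv.enorm.isOpen_inter_preimage hΩ isOpen_Ioi
  have hle : ∀ᵐ y ∂volume, y ∈ Ω → ‖v y‖ₑ ≤ normLinf Ω v := by
    rw [normLinf, eLpNorm_exponent_top]
    exact (ae_restrict_iff' hΩ.measurableSet).1 (ae_le_eLpNormEssSup (f := v))
  refine (hopen.measure_pos volume ⟨x, hx, hlt⟩).ne' (measure_mono_null ?_ hle)
  exact fun y hy hy' => (hy' hy.1).not_gt hy.2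

theorem normLinf_le_of_ae_abs_le (h : ∀ᵐ x ∂volume.restrict Ω, |v x| ≤ C) :
    normLinf Ω v ≤ ENNReal.ofReal C := by
  rw [normLinf, eLpNorm_exponent_top]
  exact eLpNormEssSup_le_of_ae_bound h

theorem normLinf_congr {w : EuclideanSpace ℝ (Fin d) → ℝ} (hΩ : MeasurableSet Ω)
    (h : EqOn v w Ω) : normLinf Ω v = normLinf Ω w :=
  eLpNorm_congr_ae (ae_restrict_of_forall_mem hΩ h)

theorem ae_abs_le_of_abs_setIntegral_le {β : Type*} [MeasurableSpace β] {μ : Measure β}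
    [IsFiniteMeasure μ] {w : β → ℝ} (hw : Integrable w μ)
    (h : ∀ B, MeasurableSet B → |∫ y in B, w y ∂μ| ≤ C * μ.real B) : ∀ᵐ y ∂μ, |w y| ≤ C := by
  have hconst : ∀ B : Set β, ∀ c : ℝ, ∫ _ in B, c ∂μ = c * μ.real B := fun B c => by
    rw [setIntegral_const, smul_eq_mul, mul_comm]
  have hupper : w ≤ᵐ[μ] fun _ => C :=
    ae_le_of_forall_setIntegral_le hw (integrable_const C) fun B hB _ =>
      (abs_le.1 (h B hB)).2.trans_eq (hconst B C).symm
  have hlower : (fun _ => -C) ≤ᵐ[μ] w :=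
    ae_le_of_forall_setIntegral_le (integrable_const (-C)) hw fun B hB _ => by
      rw [hconst, neg_mul]
      exact (abs_le.1 (h B hB)).1
  filter_upwards [hupper, hlower] with y h1 h2 using abs_le.2 ⟨h2, h1⟩

theorem abs_le_of_abs_setIntegral_le (hΩ : IsOpen Ω) (hΩb : Bornology.IsBounded Ω)
    (hC : 0 ≤ C) (hv : ContinuousOn v Ω) (hvi : IntegrableOn v Ω)
    (h : ∀ B, MeasurableSet B →
      |∫ y in B, v y ∂volume.restrict Ω| ≤ C * (volume.restrict Ω).real B) (hx : x ∈ Ω) :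
    |v x| ≤ C := by
  have : IsFiniteMeasure (volume.restrict Ω) :=
    isFiniteMeasure_restrict.2 hΩb.measure_lt_top.ne
  have hle := (enorm_le_normLinf hΩ hv hx).trans
    (normLinf_le_of_ae_abs_le (ae_abs_le_of_abs_setIntegral_le hvi h))
  rwa [← ofReal_norm, ENNReal.ofReal_le_ofReal_iff hC] at hle

end Norm

section TimeRegularity

variable {d : ℕ} {Ω : Set (EuclideanSpace ℝ (Fin d))} {T : ℝ}
  {v w : EuclideanSpace ℝ (Fin d) → ℝ → ℝ}

theorem ae_norm_le_toReal_eLpNorm_top {β E : Type*} [MeasurableSpace β] [NormedAddCommGroup E]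
    {μ : Measure β} {f : β → E} (hf : MemLp f (⊤ : ℝ≥0∞) μ) :
    ∀ᵐ x ∂μ, ‖f x‖ ≤ (eLpNorm f ⊤ μ).toReal := by
  filter_upwards [ae_le_eLpNormEssSup (f := f) (μ := μ)] with x hx
  rw [← eLpNorm_exponent_top] at hx
  exact (toReal_enorm (f x)).symm.trans_le (ENNReal.toReal_mono hf.eLpNorm_ne_top hx)

theorem lpPairing_indicatorConstLp_one {β : Type*} [MeasurableSpace β] {μ : Measure β}
    {B : Set β} (hB : MeasurableSet B) (hμB : μ B ≠ ⊤) (f : Lp ℝ ∞ μ) :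
    (ContinuousLinearMap.lsmul ℝ ℝ).lpPairing μ 1 ∞ (indicatorConstLp 1 hB hμB (1 : ℝ)) f =
      ∫ x in B, f x ∂μ := by
  rw [ContinuousLinearMap.lpPairing_eq_integral, ← integral_indicator hB]
  refine integral_congr_ae ?_
  filter_upwards [indicatorConstLp_coeFn (p := 1) (hs := hB) (hμs := hμB) (c := (1 : ℝ))] with x hx
  by_cases hxB : x ∈ B <;> simp [hx, hxB]

theorem integral_deriv_mul_clm_apply {E : Type*} [NormedAddCommGroup E] [NormedSpace ℝ E]
    [CompleteSpace E] (L : E →L[ℝ] ℝ) {U : Set ℝ} {V G : ℝ → E} (hV : IntegrableOn V U)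
    (hG : IntegrableOn G U) {φ : ℝ → ℝ} (hφ : ContDiff ℝ ∞ φ) (hφc : HasCompactSupport φ)
    (h : ∫ r in U, deriv φ r • V r = -∫ r in U, φ r • G r) :
    ∫ r in U, deriv φ r * L (V r) = -∫ r in U, φ r * L (G r) := by
  have hφ' : Continuous (deriv φ) := hφ.continuous_deriv (by simp)
  obtain ⟨C₁, hC₁⟩ := hφ'.bounded_above_of_compact_support hφc.deriv
  obtain ⟨C₂, hC₂⟩ := hφ.continuous.bounded_above_of_compact_support hφc
  have hint : IntegrableOn (fun r => deriv φ r • V r) U :=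
    hV.bdd_smul C₁ hφ'.aestronglyMeasurable (Eventually.of_forall hC₁)
  have hint' : IntegrableOn (fun r => φ r • G r) U :=
    hG.bdd_smul C₂ hφ.continuous.aestronglyMeasurable (Eventually.of_forall hC₂)
  have hL := congrArg L h
  rw [map_neg, ← L.integral_comp_comm hint, ← L.integral_comp_comm hint'] at hL
  simpa only [map_smul, smul_eq_mul] using hL

theorem continuousOn_setIntegral_of_continuousOn_uncurry {X Y : Type*} [TopologicalSpace X]
    [SecondCountableTopology X] [MeasurableSpace X] [OpensMeasurableSpace X] [T2Space X]
    [TopologicalSpace Y] [FirstCountableTopology Y] {μ : Measure X} [IsFiniteMeasureOnCompacts μ]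
    {f : X → Y → ℝ} {K B : Set X} {S : Set Y} (hK : IsCompact K) (hS : IsCompact S)
    (hf : ContinuousOn f.uncurry (K ×ˢ S)) (hB : MeasurableSet B) (hBK : B ⊆ K) :
    ContinuousOn (fun r => ∫ y in B, f y r ∂μ) S := by
  obtain ⟨M, hM⟩ := (hK.prod hS).exists_bound_of_continuousOn hf
  refine continuousOn_of_dominated (bound := fun _ => M)
    (fun r hr => ((hf.uncurry_right r hr).mono hBK).aestronglyMeasurable hB)
    (fun r hr => ae_restrict_of_forall_mem hB fun y hy => hM (y, r) ⟨hBK hy, hr⟩)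
    (integrableOn_const ((measure_mono hBK).trans_lt hK.measure_lt_top).ne)
    (ae_restrict_of_forall_mem hB fun y hy => hf.uncurry_left y (hBK hy))

theorem MemW1Inf.exists_abs_setIntegral_sub_le {t₁ t₂ : ℝ} (hΩ : IsOpen Ω)
    (hΩb : Bornology.IsBounded Ω)
    (hv : ContinuousOn v.uncurry (closure Ω ×ˢ Icc t₁ t₂)) (h : MemW1Inf Ω t₁ t₂ v) :
    ∃ K : ℝ≥0, ∀ s ∈ Ioo t₁ t₂, ∀ t ∈ Ioo t₁ t₂, s ≤ t → ∀ B, MeasurableSet B →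
      |∫ y in B, (v y t - v y s) ∂volume.restrict Ω| ≤
        K * (t - s) * (volume.restrict Ω).real B := by
  obtain ⟨V, G, hVv, hV, hG, hweak⟩ := h
  have hfin : IsFiniteMeasure (volume.restrict Ω) :=
    isFiniteMeasure_restrict.2 hΩb.measure_lt_top.ne
  refine ⟨(eLpNorm G ∞ (volume.restrict (Ioo t₁ t₂))).toNNReal, fun s hs t ht hst B hB => ?_⟩
  have hvi : ∀ r ∈ Icc t₁ t₂, IntegrableOn (fun y => v y r) B (volume.restrict Ω) := fun r hr =>
    (((hv.uncurry_right r hr).integrableOn_compact hΩb.isCompact_closure).mono_set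
      subset_closure).integrableOn
  let L : Lp ℝ ∞ (volume.restrict Ω) →L[ℝ] ℝ :=
    (ContinuousLinearMap.lsmul ℝ ℝ).lpPairing (volume.restrict Ω) 1 ∞
    (indicatorConstLp 1 hB (measure_ne_top _ B) (1 : ℝ))
  have hL : ∀ f, L f = ∫ y in B, f y ∂volume.restrict Ω :=
    lpPairing_indicatorConstLp_one hB (measure_ne_top _ B)
  have hLV : ∀ᵐ r ∂volume.restrict (Ioo t₁ t₂), L (V r) = ∫ y in B, v y r ∂volume.restrict Ω := by
    filter_upwards [hVv] with r hr
    rw [hL]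
    exact integral_congr_ae (ae_restrict_of_ae hr)
  have hLG : ∀ᵐ r ∂volume.restrict (Ioo t₁ t₂), |L (G r)| ≤
      (eLpNorm G ∞ (volume.restrict (Ioo t₁ t₂))).toReal * (volume.restrict Ω).real B := by
    filter_upwards [ae_norm_le_toReal_eLpNorm_top hG] with r hr
    rw [hL]
    exact norm_setIntegral_le_of_norm_le_const_ae (measure_lt_top _ B)
      (ae_restrict_of_ae ((ae_norm_le_toReal_eLpNorm_top (Lp.memLp (G r))).mono
        fun y hy => hy.trans hr))
  have hmean : ContinuousOn (fun r => ∫ y in B, v y r ∂volume.restrict Ω) (Icc t₁ t₂) := by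
    simp only [Measure.restrict_restrict hB]
    exact continuousOn_setIntegral_of_continuousOn_uncurry hΩb.isCompact_closure isCompact_Icc hv
      (hB.inter hΩ.measurableSet) (inter_subset_right.trans subset_closure)
  have hlip := abs_sub_le_of_weak_deriv isOpen_Ioo (hmean.mono Ioo_subset_Icc_self)
    (hmean.integrableOn_Icc.mono_set Ioo_subset_Icc_self) hLG (fun φ hφ hφc hφs => by
      rw [← integral_deriv_mul_clm_apply L (hV.integrable le_top) (hG.integrable le_top) hφ hφc
        (hweak φ hφ hφc hφs)]
      refine integral_congr_ae ?_
      filter_upwards [hLV] with r hr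
      rw [hr]) hst (ordConnected_Ioo.out hs ht)
  rw [integral_sub (hvi t (Ioo_subset_Icc_self ht)) (hvi s (Ioo_subset_Icc_self hs))]
  exact hlip.trans_eq (mul_right_comm _ _ _)

theorem MemW1Inf.exists_lipschitzOnWith {t₁ t₂ : ℝ} (hΩ : IsOpen Ω) (hΩb : Bornology.IsBounded Ω)
    (hv : ContinuousOn v.uncurry (closure Ω ×ˢ Icc t₁ t₂)) (h : MemW1Inf Ω t₁ t₂ v) :
    ∃ K : ℝ≥0, ∀ x ∈ Ω, LipschitzOnWith K (v x) (Ioo t₁ t₂) := by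
  obtain ⟨K, hK⟩ := h.exists_abs_setIntegral_sub_le hΩ hΩb hv
  have hle : ∀ x ∈ Ω, ∀ s ∈ Ioo t₁ t₂, ∀ t ∈ Ioo t₁ t₂, s ≤ t →
      |v x t - v x s| ≤ K * (t - s) := fun x hx s hs t ht hst => by
    have hcont : ContinuousOn (fun y => v y t - v y s) (closure Ω) :=
      (hv.uncurry_right t (Ioo_subset_Icc_self ht)).sub
        (hv.uncurry_right s (Ioo_subset_Icc_self hs))
    exact abs_le_of_abs_setIntegral_le (v := fun y => v y t - v y s) hΩ hΩb
      (mul_nonneg K.2 (sub_nonneg.2 hst)) (hcont.mono subset_closure)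
      ((hcont.integrableOn_compact hΩb.isCompact_closure).mono_set subset_closure)
      (hK s hs t ht hst) hx
  refine ⟨K, fun x hx => LipschitzOnWith.of_dist_le_mul fun s hs t ht => ?_⟩
  rw [Real.dist_eq, Real.dist_eq]
  rcases le_total s t with hst | hts
  · rw [abs_sub_comm, abs_sub_comm s, abs_of_nonneg (sub_nonneg.2 hst)]
    exact hle x hx s hs t ht hst
  · rw [abs_of_nonneg (sub_nonneg.2 hts)]
    exact hle x hx t ht s hs hts

theorem Regular.exists_lipschitzOnWith (hΩ : IsOpen Ω) (hΩb : Bornology.IsBounded Ω)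
    (hv : Regular Ω T v) {ε : ℝ} (hε : 0 < ε) :
    ∃ K : ℝ≥0, ∀ x ∈ Ω, LipschitzOnWith K (v x) (Icc ε T) := by
  rcases le_or_gt T ε with hT | hT
  · exact ⟨0, fun x _ s hs r hr => by simp [subsingleton_Icc_of_ge hT hs hr]⟩
  have hεT : ε / 2 < T := (half_lt_self hε).trans hT
  have hcont : ContinuousOn v.uncurry (closure Ω ×ˢ Icc (ε / 2) T) :=
    hv.continuousOn.mono (prod_mono_right (Icc_subset_Icc_left (half_pos hε).le))
  obtain ⟨K, hK⟩ := (hv.memW1Inf (ε / 2) T (half_pos hε) hεT le_rfl).exists_lipschitzOnWith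
    hΩ hΩb hcont
  refine ⟨K, fun x hx => ?_⟩
  have hclosure : closure (Ioo (ε / 2) T) = Icc (ε / 2) T := closure_Ioo hεT.ne
  have hlip := (hK x hx).closure (hclosure ▸ hcont.uncurry_left x (subset_closure hx))
  rw [hclosure] at hlip
  exact hlip.mono (Icc_subset_Icc_left (half_le_self hε.le))

/-- Continuity on `Ω̄ × [0, T]` together with Lipschitz continuity in time, uniform in space, away
from `t = 0`. Unlike `Regular` it makes no reference to weak derivatives. -/
structure TimeLipschitz (Ω : Set (EuclideanSpace ℝ (Fin d))) (T : ℝ)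
    (v : EuclideanSpace ℝ (Fin d) → ℝ → ℝ) : Prop where
  continuousOn : ContinuousOn v.uncurry (closure Ω ×ˢ Icc 0 T)
  lipschitz : ∀ ε > 0, ∃ K : ℝ≥0, ∀ x ∈ Ω, LipschitzOnWith K (v x) (Icc ε T)

theorem Regular.timeLipschitz (hΩ : IsOpen Ω) (hΩb : Bornology.IsBounded Ω)
    (hv : Regular Ω T v) : TimeLipschitz Ω T v where
  continuousOn := hv.continuousOn
  lipschitz _ hε := hv.exists_lipschitzOnWith hΩ hΩb hε

namespace TimeLipschitz

variable {α t : ℝ}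

theorem sub (hv : TimeLipschitz Ω T v) (hw : TimeLipschitz Ω T w) :
    TimeLipschitz Ω T fun x t => v x t - w x t where
  continuousOn := hv.continuousOn.sub hw.continuousOn
  lipschitz ε hε := by
    obtain ⟨K, hK⟩ := hv.lipschitz ε hε
    obtain ⟨K', hK'⟩ := hw.lipschitz ε hε
    exact ⟨K + K', fun x hx => (hK x hx).sub (hK' x hx)⟩

theorem hasCaputo (hα : α < 1) (hv : TimeLipschitz Ω T v) {x : EuclideanSpace ℝ (Fin d)}
    (hx : x ∈ Ω) (ht : t ∈ Ioc 0 T) : HasCaputo α (v x) t := by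
  obtain ⟨K, hK⟩ := hv.lipschitz (t / 2) (half_pos ht.1)
  exact hasCaputo_of_lipschitzOn hα
    ((hv.continuousOn.uncurry_left x (subset_closure hx)).mono (Icc_subset_Icc_right ht.2))
    (half_lt_self ht.1) ((hK x hx).mono (Icc_subset_Icc_right ht.2))

theorem continuousOn_caputo (hα : α < 1) (hΩb : Bornology.IsBounded Ω) (hv : TimeLipschitz Ω T v)
    (ht : t ∈ Ioc 0 T) : ContinuousOn (fun x => caputo α (v x) t) Ω := by
  obtain ⟨M, hM⟩ := (hΩb.isCompact_closure.prod isCompact_Icc).exists_bound_of_continuousOn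
    hv.continuousOn
  obtain ⟨K, hK⟩ := hv.lipschitz (t / 2) (half_pos ht.1)
  have hspace : ∀ s ∈ Icc 0 t, ContinuousOn (fun x => v x s) Ω := fun s hs =>
    (hv.continuousOn.uncurry_right s
      (mem_Icc.2 ⟨hs.1, hs.2.trans ht.2⟩)).mono subset_closure
  have hsub : ∀ s ∈ Icc 0 t, ContinuousOn (fun x => v x t - v x s) Ω := fun s hs =>
    (hspace t (right_mem_Icc.2 ht.1.le)).sub (hspace s hs)
  have hbound : ∀ x ∈ Ω, ∀ s ∈ Ioo 0 t,
      |caputoIntegrand α (v x) t s| ≤ (K + 2 * M / (t - t / 2)) * (t - s) ^ (-α) :=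
    fun x hx s hs => abs_caputoIntegrand_le hs.2 <|
      abs_sub_le_of_lipschitzOn (v := v x) (M := M) (half_lt_self ht.1)
        (fun r hr => hM (x, r) ⟨subset_closure hx, hr.1, hr.2.trans ht.2⟩)
        ((hK x hx).mono (Icc_subset_Icc_right ht.2)) s (Ioo_subset_Icc_self hs)
  refine continuousOn_const.mul ((continuousOn_const.mul
    (hsub 0 (left_mem_Icc.2 ht.1.le))).add (continuousOn_const.mul ?_))
  exact continuousOn_of_dominated
    (fun x hx => (hv.hasCaputo hα hx ht).aestronglyMeasurable)
    (fun x hx => ae_restrict_of_forall_mem measurableSet_Ioo (hbound x hx))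
    ((integrableOn_sub_rpow_neg hα t).const_mul _)
    (ae_restrict_of_forall_mem measurableSet_Ioo fun s hs =>
      continuousOn_const.mul (hsub s (Ioo_subset_Icc_self hs)))

end TimeLipschitz

end TimeRegularity

section SpatialOperator

variable {d : ℕ} {Ω : Set (EuclideanSpace ℝ (Fin d))}
  {a b : Fin d → EuclideanSpace ℝ (Fin d) → ℝ} {c : EuclideanSpace ℝ (Fin d) → ℝ}
  {v w : EuclideanSpace ℝ (Fin d) → ℝ} {k : Fin d} {x : EuclideanSpace ℝ (Fin d)}

theorem partialDeriv_eq_fderiv (hv : DifferentiableAt ℝ v x) :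
    partialDeriv k v x = fderiv ℝ v x (EuclideanSpace.single k 1) :=
  hv.lineDeriv_eq_fderiv

theorem contDiffOn_partialDeriv (hΩ : IsOpen Ω) (hv : ContDiffOn ℝ 2 v Ω) (k : Fin d) :
    ContDiffOn ℝ 1 (partialDeriv k v) Ω := by
  have h := (hv.fderiv_of_isOpen hΩ (m := 1) (by norm_num)).clm_apply
    (contDiffOn_const (c := EuclideanSpace.single k (1 : ℝ)))
  exact h.congr fun x hx => partialDeriv_eq_fderiv
    ((hv.contDiffAt (hΩ.mem_nhds hx)).differentiableAt two_ne_zero)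

theorem continuousOn_partialDeriv (hΩ : IsOpen Ω) (hv : ContDiffOn ℝ 1 v Ω) (k : Fin d) :
    ContinuousOn (partialDeriv k v) Ω := by
  have h := (hv.continuousOn_fderiv_of_isOpen hΩ le_rfl).clm_apply
    (continuousOn_const (c := EuclideanSpace.single k (1 : ℝ)))
  exact h.congr fun x hx => partialDeriv_eq_fderiv
    ((hv.contDiffAt (hΩ.mem_nhds hx)).differentiableAt one_ne_zero)

theorem partialDeriv_sub (hv : DifferentiableAt ℝ v x) (hw : DifferentiableAt ℝ w x) :
    partialDeriv k (fun y => v y - w y) x = partialDeriv k v x - partialDeriv k w x := by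
  rw [partialDeriv_eq_fderiv hv, partialDeriv_eq_fderiv hw, partialDeriv_eq_fderiv (hv.fun_sub hw),
    fderiv_fun_sub hv hw, sub_apply]

theorem partialDeriv_const_mul (k : Fin d) (C : ℝ) (v : EuclideanSpace ℝ (Fin d) → ℝ) :
    partialDeriv k (fun y => C * v y) = fun x => C * partialDeriv k v x :=
  funext fun _ => deriv_const_mul_field C

theorem partialDeriv_partialDeriv_sub (hΩ : IsOpen Ω) (hv : ContDiffOn ℝ 2 v Ω)
    (hw : ContDiffOn ℝ 2 w Ω) (hx : x ∈ Ω) :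
    partialDeriv k (partialDeriv k fun y => v y - w y) x =
      partialDeriv k (partialDeriv k v) x - partialDeriv k (partialDeriv k w) x := by
  have hdiff : ∀ {v}, ContDiffOn ℝ 2 v Ω → DifferentiableAt ℝ (partialDeriv k v) x := fun hv =>
    ((contDiffOn_partialDeriv hΩ hv k).contDiffAt (hΩ.mem_nhds hx)).differentiableAt one_ne_zero
  have heq : (partialDeriv k fun y => v y - w y) =ᶠ[𝓝 x]
      fun y => partialDeriv k v y - partialDeriv k w y := by
    filter_upwards [hΩ.mem_nhds hx] with y hy
    exact partialDeriv_sub ((hv.contDiffAt (hΩ.mem_nhds hy)).differentiableAt two_ne_zero)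
      ((hw.contDiffAt (hΩ.mem_nhds hy)).differentiableAt two_ne_zero)
  exact heq.lineDeriv_eq.trans (partialDeriv_sub (hdiff hv) (hdiff hw))

theorem spatialOp_const_mul (C : ℝ) (v : EuclideanSpace ℝ (Fin d) → ℝ)
    (x : EuclideanSpace ℝ (Fin d)) :
    spatialOp a b c (fun y => C * v y) x = C * spatialOp a b c v x := by
  simp only [spatialOp, partialDeriv_const_mul, mul_add, Finset.mul_sum]
  congr 1
  · exact Finset.sum_congr rfl fun k _ => by ring
  · ring

theorem spatialOp_sub (hΩ : IsOpen Ω) (hv : ContDiffOn ℝ 2 v Ω) (hw : ContDiffOn ℝ 2 w Ω)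
    (hx : x ∈ Ω) :
    spatialOp a b c (fun y => v y - w y) x = spatialOp a b c v x - spatialOp a b c w x := by
  have hv' := (hv.contDiffAt (hΩ.mem_nhds hx)).differentiableAt two_ne_zero
  have hw' := (hw.contDiffAt (hΩ.mem_nhds hx)).differentiableAt two_ne_zero
  simp only [spatialOp, partialDeriv_sub hv' hw',
    partialDeriv_partialDeriv_sub hΩ hv hw hx]
  rw [add_sub_add_comm, ← Finset.sum_sub_distrib, mul_sub]
  congr 1
  exact Finset.sum_congr rfl fun k _ => by ring

theorem continuousOn_spatialOp (hΩ : IsOpen Ω) (ha : ∀ k, ContinuousOn (a k) Ω)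
    (hb : ∀ k, ContinuousOn (b k) Ω) (hc : ContinuousOn c Ω) (hv : ContDiffOn ℝ 2 v Ω) :
    ContinuousOn (spatialOp a b c v) Ω := by
  refine ContinuousOn.add (continuousOn_finsetSum _ fun k _ => ?_) (hc.mul hv.continuousOn)
  exact ((ha k).neg.mul (continuousOn_partialDeriv hΩ (contDiffOn_partialDeriv hΩ hv k) k)).add
    ((hb k).mul (continuousOn_partialDeriv hΩ (hv.of_le one_le_two) k))

theorem deriv_deriv_nonpos_of_isLocalMax {f : ℝ → ℝ} {r : ℝ} (hf : ContinuousAt f r)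
    (h : IsLocalMax f r) : deriv (deriv f) r ≤ 0 := by
  by_contra! hpos
  have hmin : IsLocalMin f r := isLocalMin_of_deriv_deriv_pos hpos h.deriv_eq_zero hf
  have hconst : f =ᶠ[𝓝 r] fun _ => f r := by
    filter_upwards [h, hmin] with y h1 h2 using le_antisymm h1 h2
  have hzero : deriv (deriv f) r = 0 := by
    rw [hconst.deriv.deriv_eq, deriv_const', deriv_const]
  exact hpos.ne' hzero

theorem partialDeriv_add_smul_single (k : Fin d) (v : EuclideanSpace ℝ (Fin d) → ℝ)
    (x : EuclideanSpace ℝ (Fin d)) (r : ℝ) :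
    partialDeriv k v (x + r • EuclideanSpace.single k 1) =
      deriv (fun s : ℝ => v (x + s • EuclideanSpace.single k 1)) r := by
  have h := deriv_comp_const_add (fun s : ℝ => v (x + s • EuclideanSpace.single k 1)) r 0
  rw [add_zero] at h
  rw [← h, partialDeriv, lineDeriv]
  simp only [add_smul, add_assoc]

theorem partialDeriv_partialDeriv_eq_deriv_deriv (k : Fin d) (v : EuclideanSpace ℝ (Fin d) → ℝ)
    (x : EuclideanSpace ℝ (Fin d)) :
    partialDeriv k (partialDeriv k v) x =
      deriv (deriv fun s : ℝ => v (x + s • EuclideanSpace.single k 1)) 0 := by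
  simp only [partialDeriv.eq_1 k (partialDeriv k v), lineDeriv, partialDeriv_add_smul_single]

theorem isLocalMax_comp_line (h : IsLocalMax v x) (e : EuclideanSpace ℝ (Fin d)) :
    IsLocalMax (fun s : ℝ => v (x + s • e)) 0 := by
  have hline : Tendsto (fun s : ℝ => x + s • e) (𝓝 0) (𝓝 x) :=
    Continuous.tendsto' (by fun_prop) _ _ (by rw [zero_smul, add_zero])
  filter_upwards [hline.eventually h] with s hs
  rwa [zero_smul, add_zero]

theorem partialDeriv_eq_zero_of_isLocalMax (h : IsLocalMax v x) : partialDeriv k v x = 0 :=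
  (isLocalMax_comp_line h _).deriv_eq_zero

theorem partialDeriv_partialDeriv_nonpos_of_isLocalMax (hv : ContinuousAt v x)
    (h : IsLocalMax v x) : partialDeriv k (partialDeriv k v) x ≤ 0 := by
  rw [partialDeriv_partialDeriv_eq_deriv_deriv]
  refine deriv_deriv_nonpos_of_isLocalMax ?_ (isLocalMax_comp_line h _)
  exact ContinuousAt.comp_of_eq hv (by fun_prop) (by rw [zero_smul, add_zero])

theorem mul_le_spatialOp_of_isLocalMax (ha : ∀ k, 0 ≤ a k x) (hv : ContinuousAt v x)
    (h : IsLocalMax v x) : c x * v x ≤ spatialOp a b c v x := by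
  refine le_add_of_nonneg_left (Finset.sum_nonneg fun k _ => ?_)
  rw [partialDeriv_eq_zero_of_isLocalMax h, mul_zero, add_zero]
  exact mul_nonneg_of_nonpos_of_nonpos (neg_nonpos.2 (ha k))
    (partialDeriv_partialDeriv_nonpos_of_isLocalMax hv h)

end SpatialOperator

section SupNorm

/-- The supremum of `|v|` over `s`: the maximum norm on the domain. It is `0` if `s` is empty or
`v` is unbounded on `s`. -/
def supNormOn {X : Type*} (s : Set X) (v : X → ℝ) : ℝ :=
  ⨆ x : s, |v x|

variable {X : Type*} {s : Set X} {v w : X → ℝ} {x : X} {C M : ℝ}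

theorem supNormOn_nonneg (s : Set X) (v : X → ℝ) : 0 ≤ supNormOn s v :=
  Real.iSup_nonneg fun _ => abs_nonneg _

theorem supNormOn_le (hC : 0 ≤ C) (h : ∀ x ∈ s, |v x| ≤ C) : supNormOn s v ≤ C :=
  Real.iSup_le (fun x => h x x.2) hC

theorem abs_le_supNormOn (hM : ∀ x ∈ s, |v x| ≤ M) (hx : x ∈ s) : |v x| ≤ supNormOn s v :=
  le_ciSup (f := fun x : s => |v x|) ⟨M, forall_mem_range.2 fun y => hM y y.2⟩ ⟨x, hx⟩

theorem supNormOn_le_add (hM : ∀ x ∈ s, |w x| ≤ M) (hC : 0 ≤ C)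
    (h : ∀ x ∈ s, |v x - w x| ≤ C) : supNormOn s v ≤ supNormOn s w + C :=
  supNormOn_le (add_nonneg (supNormOn_nonneg s w) hC) fun x hx => by
    have htri : |v x| - |w x| ≤ |v x - w x| := abs_sub_abs_le_abs_sub _ _
    linarith [h x hx, abs_le_supNormOn hM hx]

theorem exists_mem_abs_eq_supNormOn [TopologicalSpace X] (hs : IsCompact (closure s))
    (hv : ContinuousOn v (closure s)) (hfr : ∀ x ∈ frontier s, v x = 0)
    (hpos : 0 < supNormOn s v) : ∃ x ∈ s, |v x| = supNormOn s v := by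
  have hne : s.Nonempty := by
    by_contra! hempty
    exact hpos.not_ge (supNormOn_le le_rfl (by simp [hempty]))
  obtain ⟨x, hx, hmax⟩ := hs.exists_isMaxOn hne.closure hv.abs
  have hle : supNormOn s v ≤ |v x| :=
    supNormOn_le (abs_nonneg _) fun y hy => hmax (subset_closure hy)
  have hxs : x ∈ s := by
    by_contra hxs
    have hfx : v x = 0 := hfr x ⟨hx, fun hxi => hxs (interior_subset hxi)⟩
    exact hpos.not_ge (hle.trans_eq (abs_eq_zero.2 hfx))
  exact ⟨x, hxs, (abs_le_supNormOn (fun y hy => hmax (subset_closure hy)) hxs).antisymm hle⟩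

end SupNorm

section MaximumPrinciple

variable {d : ℕ} {Ω : Set (EuclideanSpace ℝ (Fin d))}
  {a b : Fin d → EuclideanSpace ℝ (Fin d) → ℝ} {c : EuclideanSpace ℝ (Fin d) → ℝ}
  {α lam T t : ℝ} {e : EuclideanSpace ℝ (Fin d) → ℝ → ℝ} {x : EuclideanSpace ℝ (Fin d)}

theorem TimeLipschitz.exists_abs_le (hΩb : Bornology.IsBounded Ω) (he : TimeLipschitz Ω T e) :
    ∃ M, ∀ t ∈ Icc 0 T, ∀ x ∈ Ω, |e x t| ≤ M := by
  obtain ⟨M, hM⟩ := (hΩb.isCompact_closure.prod isCompact_Icc).exists_bound_of_continuousOn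
    he.continuousOn
  exact ⟨M, fun t ht x hx => hM (x, t) ⟨subset_closure hx, ht⟩⟩

theorem TimeLipschitz.abs_le_supNormOn (hΩb : Bornology.IsBounded Ω) (he : TimeLipschitz Ω T e)
    (ht : t ∈ Icc 0 T) (hx : x ∈ Ω) : |e x t| ≤ supNormOn Ω fun y => e y t := by
  obtain ⟨M, hM⟩ := he.exists_abs_le hΩb
  exact TimeFrac.abs_le_supNormOn (hM t ht) hx

theorem TimeLipschitz.abs_supNormOn_sub_le (hΩb : Bornology.IsBounded Ω)
    (he : TimeLipschitz Ω T e) {s C : ℝ} (hs : s ∈ Icc 0 T) (ht : t ∈ Icc 0 T) (hC : 0 ≤ C)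
    (h : ∀ x ∈ Ω, |e x t - e x s| ≤ C) :
    |supNormOn Ω (fun x => e x t) - supNormOn Ω fun x => e x s| ≤ C := by
  obtain ⟨M, hM⟩ := he.exists_abs_le hΩb
  have hts := supNormOn_le_add (v := fun x => e x t) (hM s hs) hC h
  have hst := supNormOn_le_add (v := fun x => e x s) (hM t ht) hC fun x hx =>
    (abs_sub_comm _ _).trans_le (h x hx)
  exact abs_sub_le_iff.2 ⟨by linarith, by linarith⟩

theorem TimeLipschitz.continuousOn_supNormOn (hΩb : Bornology.IsBounded Ω)
    (he : TimeLipschitz Ω T e) : ContinuousOn (fun t => supNormOn Ω fun x => e x t) (Icc 0 T) := by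
  have huc := (hΩb.isCompact_closure.prod isCompact_Icc).uniformContinuousOn_of_continuous
    he.continuousOn
  rw [Metric.uniformContinuousOn_iff_le] at huc
  rw [Metric.continuousOn_iff]
  intro t ht ε hε
  obtain ⟨δ, hδ, hδe⟩ := huc (ε / 2) (half_pos hε)
  refine ⟨δ, hδ, fun s hs hst => ?_⟩
  refine (he.abs_supNormOn_sub_le hΩb ht hs (half_pos hε).le fun x hx => ?_).trans_lt
    (half_lt_self hε)
  exact hδe (x, s) ⟨subset_closure hx, hs⟩ (x, t) ⟨subset_closure hx, ht⟩
    (by rw [dist_prod_same_left]; exact hst.le)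

theorem TimeLipschitz.exists_lipschitzOnWith_supNormOn (hΩb : Bornology.IsBounded Ω)
    (he : TimeLipschitz Ω T e) {ε : ℝ} (hε : 0 < ε) :
    ∃ K : ℝ≥0, LipschitzOnWith K (fun t => supNormOn Ω fun x => e x t) (Icc ε T) := by
  obtain ⟨K, hK⟩ := he.lipschitz ε hε
  have hsub : Icc ε T ⊆ Icc 0 T := Icc_subset_Icc_left hε.le
  exact ⟨K, LipschitzOnWith.of_dist_le_mul fun t ht s hs =>
    he.abs_supNormOn_sub_le hΩb (hsub hs) (hsub ht) (by positivity) fun x hx =>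
      (hK x hx).dist_le_mul t ht s hs⟩

theorem mul_le_abs_of_abs_eq_one {σ : ℝ} (hσ : |σ| = 1) (r : ℝ) : σ * r ≤ |r| :=
  (le_abs_self _).trans_eq (by rw [abs_mul, hσ, one_mul])

theorem caputo_le_mul_caputo (hα : α ∈ Ioo (0 : ℝ) 1) (ht : 0 < t) {m v : ℝ → ℝ} {σ : ℝ}
    (hm : HasCaputo α m t) (hv : HasCaputo α v t) (hσ : |σ| = 1) (hmt : m t = σ * v t)
    (h : ∀ s ∈ Ico 0 t, |v s| ≤ m s) : caputo α m t ≤ σ * caputo α v t := by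
  rw [← caputo_const_mul]
  refine caputo_le_caputo hα ht hm (hv.const_mul σ) fun s hs => ?_
  rw [hmt]
  exact sub_le_sub_left ((mul_le_abs_of_abs_eq_one hσ _).trans (h s hs)) _

theorem mul_le_mul_spatialOp {v : EuclideanSpace ℝ (Fin d) → ℝ} {σ : ℝ} (hσ : |σ| = 1)
    (ha : ∀ k, 0 ≤ a k x) (hc : lam ≤ c x) (hv : ContinuousAt v x)
    (h : ∀ᶠ y in 𝓝 x, |v y| ≤ σ * v x) : lam * (σ * v x) ≤ σ * spatialOp a b c v x := by
  have hmax : IsLocalMax (fun y => σ * v y) x := by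
    filter_upwards [h] with y hy using (mul_le_abs_of_abs_eq_one hσ _).trans hy
  calc lam * (σ * v x) ≤ c x * (σ * v x) :=
        mul_le_mul_of_nonneg_right hc ((abs_nonneg _).trans h.self_of_nhds)
    _ ≤ spatialOp a b c (fun y => σ * v y) x :=
        mul_le_spatialOp_of_isLocalMax ha (continuousAt_const.mul hv) hmax
    _ = σ * spatialOp a b c v x := spatialOp_const_mul σ v x

theorem caputo_supNormOn_add_le (hα : α ∈ Ioo (0 : ℝ) 1) (hΩ : IsOpen Ω)
    (hΩb : Bornology.IsBounded Ω) (ha : ∀ k, 0 ≤ a k x) (hc : lam ≤ c x)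
    (he : TimeLipschitz Ω T e) (ht : t ∈ Ioc 0 T)
    (hm : HasCaputo α (fun s => supNormOn Ω fun y => e y s) t) (hx : x ∈ Ω)
    (hmax : |e x t| = supNormOn Ω fun y => e y t) :
    caputo α (fun s => supNormOn Ω fun y => e y s) t + lam * supNormOn Ω (fun y => e y t) ≤
      |caputo α (e x) t + spatialOp a b c (fun y => e y t) x| := by
  have htT : t ∈ Icc 0 T := Ioc_subset_Icc_self ht
  obtain ⟨σ, hσ, hσe⟩ : ∃ σ : ℝ, |σ| = 1 ∧ |e x t| = σ * e x t := by
    rcases abs_choice (e x t) with h | h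
    · exact ⟨1, abs_one, by rw [h, one_mul]⟩
    · exact ⟨-1, by rw [abs_neg, abs_one], by rw [h, neg_one_mul]⟩
  have hmt : supNormOn Ω (fun y => e y t) = σ * e x t := hmax.symm.trans hσe
  have hcont : ContinuousAt (fun y => e y t) x :=
    ((he.continuousOn.uncurry_right t htT).mono subset_closure).continuousAt (hΩ.mem_nhds hx)
  have htime := caputo_le_mul_caputo hα ht.1 hm (he.hasCaputo hα.2 hx ht) hσ hmt fun s hs =>
    he.abs_le_supNormOn hΩb ⟨hs.1, hs.2.le.trans ht.2⟩ hx
  have hspace : lam * (σ * e x t) ≤ σ * spatialOp a b c (fun y => e y t) x := by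
    refine mul_le_mul_spatialOp (v := fun y => e y t) hσ ha hc hcont ?_
    filter_upwards [hΩ.mem_nhds hx] with y hy
    exact (he.abs_le_supNormOn hΩb htT hy).trans_eq hmt
  calc _ ≤ σ * (caputo α (e x) t + spatialOp a b c (fun y => e y t) x) := by
        rw [mul_add, hmt]
        exact add_le_add htime hspace
    _ ≤ _ := mul_le_abs_of_abs_eq_one hσ _

theorem TimeLipschitz.isSubsolution_supNormOn (hα : α ∈ Ioo (0 : ℝ) 1) (hΩ : IsOpen Ω)
    (hΩb : Bornology.IsBounded Ω) (ha : ∀ k, ContinuousOn (a k) Ω)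
    (hb : ∀ k, ContinuousOn (b k) Ω) (hc : ContinuousOn c Ω) (ha0 : ∀ k, ∀ x ∈ Ω, 0 ≤ a k x)
    (hlam : ∀ x ∈ Ω, lam ≤ c x) (he : TimeLipschitz Ω T e)
    (heC : ∀ t ∈ Ioc 0 T, ContDiffOn ℝ 2 (fun x => e x t) Ω) (he0 : ∀ x ∈ Ω, e x 0 = 0)
    (hefr : ∀ x ∈ frontier Ω, ∀ t ∈ Ioc 0 T, e x t = 0) :
    IsSubsolution α lam T
      (fun t => normLinf Ω fun x => caputo α (e x) t + spatialOp a b c (fun y => e y t) x)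
      fun t => supNormOn Ω fun x => e x t where
  continuousOn := he.continuousOn_supNormOn hΩb
  map_zero := (supNormOn_le le_rfl fun x hx => (abs_eq_zero.2 (he0 x hx)).le).antisymm
    (supNormOn_nonneg _ _)
  lipschitz _ hε := he.exists_lipschitzOnWith_supNormOn hΩb hε
  caputo_add_le t ht := by
    rcases (supNormOn_nonneg Ω fun x => e x t).eq_or_lt with hzero | hpos
    · have hle : caputo α (fun s => supNormOn Ω fun y => e y s) t ≤ 0 :=
        caputo_nonpos_of_forall_le hα ht.1 fun s _ => hzero.symm.trans_le (supNormOn_nonneg _ _)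
      rw [← hzero, mul_zero, add_zero, ENNReal.ofReal_of_nonpos hle]
      exact zero_le
    obtain ⟨x, hx, hmax⟩ := exists_mem_abs_eq_supNormOn hΩb.isCompact_closure
      (he.continuousOn.uncurry_right t (Ioc_subset_Icc_self ht)) (fun x hx => hefr x hx t ht) hpos
    obtain ⟨K, hK⟩ := he.exists_lipschitzOnWith_supNormOn hΩb (half_pos ht.1)
    have hm : HasCaputo α (fun s => supNormOn Ω fun y => e y s) t := hasCaputo_of_lipschitzOn hα.2
      ((he.continuousOn_supNormOn hΩb).mono (Icc_subset_Icc_right ht.2)) (half_lt_self ht.1)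
      (hK.mono (Icc_subset_Icc_right ht.2))
    have hcont := (he.continuousOn_caputo hα.2 hΩb ht).add
      (continuousOn_spatialOp hΩ ha hb hc (heC t ht))
    refine le_trans ?_ (enorm_le_normLinf hΩ hcont hx)
    rw [← ofReal_norm]
    exact ENNReal.ofReal_le_ofReal (caputo_supNormOn_add_le hα hΩ hΩb (fun k => ha0 k x hx)
      (hlam x hx) he ht hm hx hmax)

end MaximumPrinciple

section Error

variable {d : ℕ} {Ω : Set (EuclideanSpace ℝ (Fin d))}
  {a b : Fin d → EuclideanSpace ℝ (Fin d) → ℝ} {c : EuclideanSpace ℝ (Fin d) → ℝ}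
  {f u uh : EuclideanSpace ℝ (Fin d) → ℝ → ℝ} {α lam T t : ℝ}

theorem residual_eq_caputo_sub_add_spatialOp_sub (hα : α < 1) (hΩ : IsOpen Ω)
    (hΩb : Bornology.IsBounded Ω) (hu : Regular Ω T u) (huh : Regular Ω T uh)
    {x : EuclideanSpace ℝ (Fin d)} (hx : x ∈ Ω) (ht : t ∈ Ioc 0 T)
    (hu_eq : caputo α (u x) t + spatialOp a b c (fun y => u y t) x = f x t) :
    residual α a b c f uh x t = caputo α (fun s => uh x s - u x s) t +
      spatialOp a b c (fun y => uh y t - u y t) x := by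
  rw [residual, ← hu_eq, caputo_sub ((huh.timeLipschitz hΩ hΩb).hasCaputo hα hx ht)
    ((hu.timeLipschitz hΩ hΩb).hasCaputo hα hx ht),
    spatialOp_sub hΩ (huh.contDiffOn t ht) (hu.contDiffOn t ht) hx]
  exact add_sub_add_comm _ _ _ _

theorem isSubsolution_supNormOn_sub (hα : α ∈ Ioo (0 : ℝ) 1) (hΩ : IsOpen Ω)
    (hΩb : Bornology.IsBounded Ω) (ha : ∀ k, ContinuousOn (a k) Ω)
    (hb : ∀ k, ContinuousOn (b k) Ω) (hc : ContinuousOn c Ω) (ha0 : ∀ k, ∀ x ∈ Ω, 0 ≤ a k x)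
    (hlam : ∀ x ∈ Ω, lam ≤ c x) (hu : Regular Ω T u) (huh : Regular Ω T uh)
    (h_init : ∀ x ∈ Ω, uh x 0 = u x 0) (hbdry : ∀ x ∈ frontier Ω, ∀ t ∈ Ioc 0 T, uh x t = u x t)
    (hu_eq : ∀ x ∈ Ω, ∀ t ∈ Ioc 0 T,
      caputo α (u x) t + spatialOp a b c (fun y => u y t) x = f x t) :
    IsSubsolution α lam T (fun t => normLinf Ω fun x => residual α a b c f uh x t)
      fun t => supNormOn Ω fun x => uh x t - u x t := by
  have he := TimeLipschitz.isSubsolution_supNormOn hα hΩ hΩb ha hb hc ha0 hlam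
    ((huh.timeLipschitz hΩ hΩb).sub (hu.timeLipschitz hΩ hΩb))
    (fun t ht => (huh.contDiffOn t ht).sub (hu.contDiffOn t ht))
    (fun x hx => sub_eq_zero.2 (h_init x hx)) (fun x hx t ht => sub_eq_zero.2 (hbdry x hx t ht))
  refine { he with caputo_add_le := fun t ht => (he.caputo_add_le t ht).trans_eq ?_ }
  exact normLinf_congr hΩ.measurableSet fun x hx =>
    (residual_eq_caputo_sub_add_spatialOp_sub hα.2 hΩ hΩb hu huh hx ht (hu_eq x hx t ht)).symm

theorem TimeLipschitz.normLinf_le_ofReal_supNormOn {e : EuclideanSpace ℝ (Fin d) → ℝ → ℝ}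
    (hΩ : MeasurableSet Ω) (hΩb : Bornology.IsBounded Ω) (he : TimeLipschitz Ω T e)
    (ht : t ∈ Icc 0 T) :
    normLinf Ω (fun x => e x t) ≤ ENNReal.ofReal (supNormOn Ω fun x => e x t) :=
  normLinf_le_of_ae_abs_le (ae_restrict_of_forall_mem hΩ fun _ hx =>
    he.abs_le_supNormOn hΩb ht hx)

end Error

theorem theorem2_general {d : ℕ} {Ω : Set (EuclideanSpace ℝ (Fin d))} (hΩ : IsOpen Ω)
    (hΩb : Bornology.IsBounded Ω) {T α lam : ℝ} (hα : α ∈ Ioo (0 : ℝ) 1)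
    {a b : Fin d → EuclideanSpace ℝ (Fin d) → ℝ} {c : EuclideanSpace ℝ (Fin d) → ℝ}
    (ha : ∀ k, ContinuousOn (a k) Ω) (hb : ∀ k, ContinuousOn (b k) Ω) (hc : ContinuousOn c Ω)
    (ha0 : ∀ k, ∀ x ∈ Ω, 0 ≤ a k x) (hlam : 0 ≤ lam) (hc_lam : ∀ x ∈ Ω, lam ≤ c x)
    {f u uh : EuclideanSpace ℝ (Fin d) → ℝ → ℝ} (hu : Regular Ω T u) (huh : Regular Ω T uh)
    (h_init : ∀ x ∈ Ω, uh x 0 = u x 0) (hbdry : ∀ x ∈ frontier Ω, ∀ t ∈ Ioc 0 T, uh x t = u x t)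
    (hu_eq : ∀ x ∈ Ω, ∀ t ∈ Ioc 0 T,
      caputo α (u x) t + spatialOp a b c (fun y => u y t) x = f x t) :
    (∀ t ∈ Ioc 0 T,
      normLinf Ω (fun x => uh x t - u x t) ≤
        invCaputoAdd α lam (fun s => normLinf Ω (fun x => residual α a b c f uh x s)) t) ∧
    (∀ E : ℝ → ℝ, ContinuousOn E (Ioc 0 T) → (∀ t ∈ Icc 0 T, 0 ≤ E t) →
      (∀ t ∈ Ioc 0 T, HasCaputo α E t) →
      (∀ t ∈ Ioc 0 T,
        ((normLinf Ω (fun x => residual α a b c f uh x t) : ENNReal) : EReal) ≤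
          ((caputo α E t + lam * E t : ℝ) : EReal)) →
      ∀ t ∈ Icc 0 T, normLinf Ω (fun x => uh x t - u x t) ≤ ENNReal.ofReal (E t)) ∧
    (∀ t ∈ Ioc 0 T,
      normLinf Ω (fun x => uh x t - u x t) ≤
        ⨆ s ∈ Ioc 0 t, normLinf Ω (fun x => residual α a b c f uh x s) /
          ENNReal.ofReal (barrierR₀ α lam s)) ∧
    (∀ τ : ℝ, 0 < τ → ∀ t ∈ Ioc 0 T,
      normLinf Ω (fun x => uh x t - u x t) ≤
        ENNReal.ofReal (t ^ (α - 1)) *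
          ⨆ s ∈ Ioc 0 t, normLinf Ω (fun x => residual α a b c f uh x s) /
            ENNReal.ofReal (barrierR₁ α lam τ s)) ∧
    (∀ τ : ℝ, 0 < τ → ∀ t ∈ Ioc 0 T,
      normLinf Ω (fun x => uh x t - u x t) ≤
        ENNReal.ofReal (barrierE₁ α τ t) *
          ⨆ s ∈ Ioc 0 t, normLinf Ω (fun x => residual α a b c f uh x s) /
            ENNReal.ofReal (barrierR₁ α lam τ s)) ∧
    (∀ s : ℝ, 0 < s → s ^ (-(1 - α)) * min ((1 - α) * s) 1 ≤ rho α s) := by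
  have hsub := isSubsolution_supNormOn_sub hα hΩ hΩb ha hb hc ha0 hc_lam hu huh h_init hbdry hu_eq
  have hnorm : ∀ t ∈ Icc 0 T, normLinf Ω (fun x => uh x t - u x t) ≤
      ENNReal.ofReal (supNormOn Ω fun x => uh x t - u x t) := fun t ht =>
    TimeLipschitz.normLinf_le_ofReal_supNormOn (e := fun x t => uh x t - u x t) hΩ.measurableSet hΩb
      ((huh.timeLipschitz hΩ hΩb).sub (hu.timeLipschitz hΩ hΩb)) ht
  have hE₁ := fun τ (hτ : 0 < τ) t (ht : t ∈ Ioc 0 T) =>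
    (hnorm t (Ioc_subset_Icc_self ht)).trans
      (hsub.ofReal_le_barrierE₁_mul_iSup_div hα hlam hτ ht)
  refine ⟨fun t ht => ?_, fun E hE hE0 hEC hER t ht => ?_, fun t ht => ?_, fun τ hτ t ht => ?_,
    hE₁, fun s hs => le_rho hα hs⟩
  · exact (hnorm t (Ioc_subset_Icc_self ht)).trans (hsub.ofReal_le_invCaputoAdd hα hlam ht)
  · exact (hnorm t ht).trans
      (ENNReal.ofReal_le_ofReal (hsub.le_of_le_caputo_add hα hlam hE hE0 hEC hER t ht))
  · exact (hnorm t (Ioc_subset_Icc_self ht)).trans (hsub.ofReal_le_iSup_div_barrierR₀ hα hlam ht)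
  · have hle : barrierE₁ α τ t ≤ t ^ (α - 1) :=
      Real.rpow_le_rpow_of_nonpos ht.1 (le_max_right _ _) (sub_nonpos.2 hα.2.le)
    exact (hE₁ τ hτ t ht).trans (mul_le_mul_left (ENNReal.ofReal_le_ofReal hle) _)

end TimeFrac

end

open Set MeasureTheory TimeFrac in
theorem theorem2 {d : ℕ} (Ω : Set (EuclideanSpace ℝ (Fin d))) (hΩ : IsOpen Ω)
    (hΩb : Bornology.IsBounded Ω) (T α lam : ℝ) (hT : 0 < T) (hα : α ∈ Ioo (0 : ℝ) 1)
    (a b : Fin d → EuclideanSpace ℝ (Fin d) → ℝ) (c : EuclideanSpace ℝ (Fin d) → ℝ)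
    (ha : ∀ k, ContinuousOn (a k) (closure Ω)) (hb : ∀ k, ContinuousOn (b k) (closure Ω))
    (hc : ContinuousOn c (closure Ω)) (ha_pos : ∀ k, ∀ x ∈ closure Ω, 0 < a k x)
    (hlam : 0 ≤ lam) (hc_lam : ∀ x ∈ closure Ω, lam ≤ c x)
    (f : EuclideanSpace ℝ (Fin d) → ℝ → ℝ) (u₀ : EuclideanSpace ℝ (Fin d) → ℝ)
    (u uh : EuclideanSpace ℝ (Fin d) → ℝ → ℝ)
    (hu : Regular Ω T u) (huh : Regular Ω T uh)
    (hu_data : HasData Ω T u₀ u) (huh_data : HasData Ω T u₀ uh)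
    (hu_eq : ∀ x ∈ Ω, ∀ t ∈ Ioc 0 T,
      caputo α (u x) t + spatialOp a b c (fun y => u y t) x = f x t) :
    -- the bound of the error by the inverse operator applied to the norm of the residual
    (∀ t ∈ Ioc 0 T,
      normLinf Ω (fun x => uh x t - u x t) ≤
        invCaputoAdd α lam (fun s => normLinf Ω (fun x => residual α a b c f uh x s)) t) ∧
    -- the bound by a general barrier function
    (∀ E : ℝ → ℝ, ContinuousOn E (Ioc 0 T) → (∀ t ∈ Icc 0 T, 0 ≤ E t) →
      (∀ t ∈ Ioc 0 T, HasCaputo α E t) →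
      (∀ t ∈ Ioc 0 T,
        ((normLinf Ω (fun x => residual α a b c f uh x t) : ENNReal) : EReal) ≤
          ((caputo α E t + lam * E t : ℝ) : EReal)) →
      ∀ t ∈ Icc 0 T, normLinf Ω (fun x => uh x t - u x t) ≤ ENNReal.ofReal (E t)) ∧
    -- the bound with the residual barrier `𝓡₀`
    (∀ t ∈ Ioc 0 T,
      normLinf Ω (fun x => uh x t - u x t) ≤
        ⨆ s ∈ Ioc 0 t, normLinf Ω (fun x => residual α a b c f uh x s) /
          ENNReal.ofReal (barrierR₀ α lam s)) ∧
    -- the bounds with the residual barrier `𝓡₁`, with either factor in front of the supremum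
    (∀ τ : ℝ, 0 < τ → ∀ t ∈ Ioc 0 T,
      normLinf Ω (fun x => uh x t - u x t) ≤
        ENNReal.ofReal (t ^ (α - 1)) *
          ⨆ s ∈ Ioc 0 t, normLinf Ω (fun x => residual α a b c f uh x s) /
            ENNReal.ofReal (barrierR₁ α lam τ s)) ∧
    (∀ τ : ℝ, 0 < τ → ∀ t ∈ Ioc 0 T,
      normLinf Ω (fun x => uh x t - u x t) ≤
        ENNReal.ofReal (barrierE₁ α τ t) *
          ⨆ s ∈ Ioc 0 t, normLinf Ω (fun x => residual α a b c f uh x s) /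
            ENNReal.ofReal (barrierR₁ α lam τ s)) ∧
    -- the lower bound on `ρ` in the definition of `𝓡₁`
    (∀ s : ℝ, 0 < s → s ^ (-(1 - α)) * min ((1 - α) * s) 1 ≤ rho α s) :=
  theorem2_general hΩ hΩb hα (fun k => (ha k).mono subset_closure)
    (fun k => (hb k).mono subset_closure) (hc.mono subset_closure)
    (fun k x hx => (ha_pos k x (subset_closure hx)).le) hlam
    (fun x hx => hc_lam x (subset_closure hx)) hu huh
    (fun x hx => (huh_data.initial x hx).trans (hu_data.initial x hx).symm)
    (fun x hx t ht => (huh_data.boundary x hx t ht).trans (hu_data.boundary x hx t ht).symm) hu_eq
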